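/- **Setting.** Let $n\ge 1$, let $X$ be a deterministic $n\times p$ real matrix with columns $x_1,\dots,x_p$, let $\beta\in\mathbb{R}^p$, and let $y=X\beta+\varepsilon$ with $\varepsilon\sim N(0,\sigma^2 I_n)$, $\sigma>0$. For a penalty level $\lambda$ let $\hat\beta(\lambda)$ be a minimizer of $b\mapsto\|y-Xb\|^2/2+\lambda\|b\|_1$, let $\hat A(\lambda)=\{j:\hat\beta_j(\lambda)\ne0\}$ be the selected model, $\hat P(\lambda)$ the orthogonal projection of $\mathbb{R}^n$ onto the span of $\{x_j: j\in\hat A(\lambda)\}$, and $\tilde B(\lambda)=\|(I-\hat P(\lambda))X\beta\|$ its bias. **Conditions.** (i) Sparsity: $A_0\subset\{1,\dots,p\}$ satisfies $\#A_0^c=q\ge1$ and $\sum_{j\in A_0}|\beta_j|\le\eta_1$. (ii) Sparse Riesz condition: for an integer $q^*\le p$ and constants $0<c_*<c^*<\infty$, $c_*\|v\|^2\le\|\sum_{j\in A}v_jx_j\|^2/n\le c^*\|v\|^2$ for all $A\subset\{1,\dots,p\}$ with $|A|=q^*$ and all $v\in\mathbb{R}^A$. Put $\eta_2=\max_{A\subset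 A_0}\|\sum_{j\in A}\beta_jx_j\|$, $C=c^*/c_*$, and, for $\lambda>0$, $r_1=\{c^*\eta_1n/(q\lambda)\}^{1/2}$, $r_2=\{c^*\eta_2^2n/(q\lambda^2)\}^{1/2}$, $$M_1^*(\lambda)=2+4r_1^2+4\sqrt C\,r_2+4C,$$ $$M_2^*(\lambda)=\tfrac83\bigl\{\tfrac14+r_1^2+r_2\sqrt{2C}(1+\sqrt C)+C(\tfrac12+\tfrac43C)\bigr\},$$ $$M_3^*(\lambda)=\tfrac83\bigl\{\tfrac14+r_1^2+r_2\sqrt C(1+2\sqrt{1+C})+\tfrac34r_2^2+C(\tfrac76+\tfrac23C)\bigr\}.$$ Let $\lambda_*=\inf\{\lambda>0:M_1^*(\lambda)q+1\le q^*\}$ ($\inf\emptyset=\infty$), and for $c_0\ge0$, $a_n\ge0$ let $\lambda_{n,p}=2\sigma\sqrt{2(1+c_0)c^*n\log(p\vee a_n)}$. Call $\lambda$ admissible if $\lambda\ge\max(\lambda_*,\lambda_{n,p})$. For $0<\alpha<\infty$ let $\zeta_\alpha(\lambda)=\bigl(\sum_{j\notin A_0}|\beta_j|^\alpha I\{\hat\beta_j(\lambda)=0\}\bigr)^{1/\alpha}$,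 and let $\zeta_\infty(\lambda)$ be the maximum of $|\beta_j|$ over $j\notin A_0$ with $\hat\beta_j(\lambda)=0$ ($0$ if there is none). Finally let $$\pi=2-\exp\Bigl(\frac{2p}{(p\vee a_n)^{1+c_0}}\Bigr)-\frac{2}{(p\vee a_n)^{1+c_0}}.$$ **Theorem 2.** There is a Borel set $\Omega_0\subset\mathbb{R}^n$, depending on $X,\beta,c_0,a_n$ only, such that, under the above conditions, $P\{\varepsilon/\sigma\in\Omega_0\}\ge\pi$ and, whenever $\varepsilon/\sigma\in\Omega_0$, for all admissible $\lambda$ a LASSO estimator exists and every LASSO estimator $\hat\beta(\lambda)$ satisfies $$\#\hat A(\lambda)\le\#\bigl(\hat A(\lambda)\cup A_0^c\bigr)\le M_1^*(\lambda)q,\qquad \tilde B^2(\lambda)\le M_2^*(\lambda)\frac{q\lambda^2}{c^*n},\qquad \zeta_2^2(\lambda)\le M_3^*(\lambda)\frac{q\lambda^2}{c^*c_*n^2},$$ and every variable $j\in\{1,\dots,p\}$ with $\beta_j^2>M_3^*(\lambda)q\lambda^2/(c^*c_*n^2)$ is selected: $j\in\hat A(\lambda)$. Consequently, if $\lambda$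 is admissible and $\beta_j^2>M_3^*(\lambda)q\lambda^2/(c^*c_*n^2)$ for all $j\notin A_0$, then for all $\alpha\in(0,\infty]$ $$P\{A_0^c\subset\hat A(\lambda),\ \tilde B(\lambda)\le\eta_2\ \text{and}\ \zeta_\alpha(\lambda)=0\}\ge\pi,$$ where the event requires a LASSO estimator to exist and the three properties to hold for every LASSO estimator. Moreover $\pi\to1$ along any sequence of $p\ge1$, $a_n\ge0$, $c_0\ge0$ with $p/(p\vee a_n)^{1+c_0}\to0$. -/

import Mathlib

open MeasureTheory ProbabilityTheory Filter Topology
open scoped ENNReal NNReal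

noncomputable section

namespace Lasso

/-- `ℝⁿ` with the Euclidean norm. -/
abbrev E (n : ℕ) : Type := EuclideanSpace ℝ (Fin n)

/-- The `j`-th design vector `x_j ∈ ℝⁿ`, i.e. the `j`-th column of `X`. -/
def col {n p : ℕ} (X : Matrix (Fin n) (Fin p) ℝ) (j : Fin p) : E n :=
  WithLp.toLp 2 fun i => X i j

/-- The mean vector `X b = ∑ j, b j • x_j`. -/
def fit {n p : ℕ} (X : Matrix (Fin n) (Fin p) ℝ) (b : Fin p → ℝ) : E n :=
  ∑ j, b j • col X j

/-- The LASSO criterion `‖y - X b‖² / 2 + lam ‖b‖₁`. -/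
def objective {n p : ℕ} (X : Matrix (Fin n) (Fin p) ℝ) (y : E n) (lam : ℝ)
    (b : Fin p → ℝ) : ℝ :=
  ‖y - fit X b‖ ^ 2 / 2 + lam * ∑ j, |b j|

/-- `b` is a LASSO estimator: a global minimizer of the LASSO criterion. -/
def IsLasso {n p : ℕ} (X : Matrix (Fin n) (Fin p) ℝ) (y : E n) (lam : ℝ)
    (b : Fin p → ℝ) : Prop :=
  ∀ b' : Fin p → ℝ, objective X y lam b ≤ objective X y lam b'

/-- The selected model `{j | b j ≠ 0}`. -/
def selected {p : ℕ} (b : Fin p → ℝ) : Finset (Fin p) :=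
  Finset.univ.filter fun j => b j ≠ 0

/-- The bias `‖(I - P) X β‖` of a model `A`, where `P` is the orthogonal projection of `ℝⁿ` onto
the span of the design vectors `x_j`, `j ∈ A`. -/
def bias {n p : ℕ} (X : Matrix (Fin n) (Fin p) ℝ) (β : Fin p → ℝ) (A : Finset (Fin p)) : ℝ :=
  ‖fit X β - (Submodule.span ℝ (col X '' (A : Set (Fin p)))).starProjection (fit X β)‖

/-- `ζ_α`, the `ℓ_α` size (`0 ≤ α ≤ ∞`) of the coefficients outside `A₀` which the model of `b`
misses: their number for `α = 0` and their maximum (`0` if there is none) for `α = ∞`. -/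
def zeta {p : ℕ} (β : Fin p → ℝ) (A₀ : Finset (Fin p)) (α : ℝ≥0∞) (b : Fin p → ℝ) : ℝ :=
  if α = 0 then ((A₀ᶜ.filter fun j => b j = 0).card : ℝ)
  else if α = ∞ then (((A₀ᶜ.filter fun j => b j = 0).sup fun j => ‖β j‖₊ : ℝ≥0) : ℝ)
  else (∑ j ∈ A₀ᶜ, |β j| ^ α.toReal * (if b j = 0 then 1 else 0)) ^ (1 / α.toReal)

/-- The sparsity condition: all but `q` coefficients lie in `A₀`, and those have `ℓ₁` norm at
most `η₁`. -/
def Sparse {p : ℕ} (β : Fin p → ℝ) (A₀ : Finset (Fin p)) (q : ℕ) (η₁ : ℝ) : Prop :=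
  A₀ᶜ.card = q ∧ ∑ j ∈ A₀, |β j| ≤ η₁

/-- `η₂ = max_{A ⊆ A₀} ‖∑_{j ∈ A} β_j x_j‖`. -/
def eta₂ {n p : ℕ} (X : Matrix (Fin n) (Fin p) ℝ) (β : Fin p → ℝ) (A₀ : Finset (Fin p)) : ℝ :=
  A₀.powerset.sup' ⟨∅, Finset.empty_mem_powerset A₀⟩ fun A => ‖∑ j ∈ A, β j • col X j‖

/-- The sparse Riesz condition with rank `qs ≤ p` and spectrum bounds `0 < cL < cU < ∞`:
`cL ≤ ‖X_A v‖² / (n ‖v‖²) ≤ cU` for all `A` of size `qs` and all vectors `v ≠ 0` indexed by `A`.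
Only the values of `v` on `A` are used. -/
def SparseRiesz {n p : ℕ} (X : Matrix (Fin n) (Fin p) ℝ) (qs : ℕ) (cL cU : ℝ) : Prop :=
  qs ≤ p ∧ 0 < cL ∧ cL < cU ∧
    ∀ A : Finset (Fin p), A.card = qs → ∀ v : Fin p → ℝ,
      cL * (n * ∑ j ∈ A, v j ^ 2) ≤ ‖∑ j ∈ A, v j • col X j‖ ^ 2 ∧
      ‖∑ j ∈ A, v j • col X j‖ ^ 2 ≤ cU * (n * ∑ j ∈ A, v j ^ 2)

/-- `r₁(lam) = (c^* η₁ n / (q lam))^{1/2}`. -/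
def r₁ (n q : ℕ) (cU η₁ lam : ℝ) : ℝ := √(cU * η₁ * n / (q * lam))

/-- `r₂(lam) = (c^* η₂² n / (q lam²))^{1/2}`. -/
def r₂ (n q : ℕ) (cU η₂ lam : ℝ) : ℝ := √(cU * η₂ ^ 2 * n / (q * lam ^ 2))

/-- `M₁^*(lam) = 2 + 4 r₁² + 4 √C r₂ + 4 C` with `C = c^* / c_*`. -/
def M₁ (n q : ℕ) (cL cU η₁ η₂ lam : ℝ) : ℝ :=
  2 + 4 * r₁ n q cU η₁ lam ^ 2 + 4 * √(cU / cL) * r₂ n q cU η₂ lam + 4 * (cU / cL)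

/-- `M₂^*(lam) = (8/3) {1/4 + r₁² + r₂ √(2C) (1 + √C) + C (1/2 + (4/3) C)}`. -/
def M₂ (n q : ℕ) (cL cU η₁ η₂ lam : ℝ) : ℝ :=
  8 / 3 * (1 / 4 + r₁ n q cU η₁ lam ^ 2
    + r₂ n q cU η₂ lam * √(2 * (cU / cL)) * (1 + √(cU / cL))
    + cU / cL * (1 / 2 + 4 / 3 * (cU / cL)))

/-- `M₃^*(lam) = (8/3) {1/4 + r₁² + r₂ √C (1 + 2 √(1+C)) + (3/4) r₂² + C (7/6 + (2/3) C)}`. -/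
def M₃ (n q : ℕ) (cL cU η₁ η₂ lam : ℝ) : ℝ :=
  8 / 3 * (1 / 4 + r₁ n q cU η₁ lam ^ 2
    + r₂ n q cU η₂ lam * √(cU / cL) * (1 + 2 * √(1 + cU / cL))
    + 3 * r₂ n q cU η₂ lam ^ 2 / 4
    + cU / cL * (7 / 6 + 2 / 3 * (cU / cL)))

/-- `lam_* = inf {lam > 0 | M₁^*(lam) q + 1 ≤ q^*}`, with `inf ∅ = ∞`. -/
def lamStar (n q qs : ℕ) (cL cU η₁ η₂ : ℝ) : EReal :=
  sInf ((fun l : ℝ => (l : EReal)) ''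
    {l : ℝ | 0 < l ∧ M₁ n q cL cU η₁ η₂ l * q + 1 ≤ qs})

/-- `lam_{n,p} = 2 σ √(2 (1 + c₀) c^* n log (p ∨ a))`. -/
def lamNP (n p : ℕ) (σ c₀ a cU : ℝ) : ℝ :=
  2 * σ * √(2 * (1 + c₀) * cU * n * Real.log (max (p : ℝ) a))

/-- The penalty interval `lam ≥ max (lam_*, lam_{n,p})`. -/
def Admissible (n p q qs : ℕ) (cL cU η₁ η₂ σ c₀ a lam : ℝ) : Prop :=
  lamStar n q qs cL cU η₁ η₂ ≤ (lam : EReal) ∧ lamNP n p σ c₀ a cU ≤ lam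

/-- The threshold `M₃^*(lam) q lam² / (c^* c_* n²)`. -/
def threshold (n q : ℕ) (cL cU η₁ η₂ lam : ℝ) : ℝ :=
  M₃ n q cL cU η₁ η₂ lam * q * lam ^ 2 / (cU * cL * (n : ℝ) ^ 2)

/-- The probability bound
`2 - exp (2 p / (p ∨ a)^{1 + c₀}) - 2 / (p ∨ a)^{1 + c₀}`. -/
def probBound (p : ℕ) (a c₀ : ℝ) : ℝ :=
  2 - Real.exp (2 * p / max (p : ℝ) a ^ (1 + c₀)) - 2 / max (p : ℝ) a ^ (1 + c₀)

end Lasso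

end

/-!
On a suitable event all models reached by the LASSO are small, and then the first order conditions
control the bias and the missed coefficients.

**Energy inequality** (`energy_le`, `normalized_energy`). Let `r = y - X b` be the residual of a
LASSO estimator, `g_j = ⟨x_j, r⟩`, and let `A` be a model containing the active set. The projection
`P_A r` is determined by the numbers `g_j`, `j ∈ A`; let `v₄` and `v₃` be its parts belonging to
`A ∩ A₀` and to `A \ A₀`. Testing `r` against `v₄` and against `∑ j ∉ A, β_j x_j` and adding, the
unknown cross terms cancel and

`‖v₄‖² + ‖(I - P_A) X β‖² ≤ ⟨v₄ - (I - P_A) X β, ε⟩ + (known terms)`.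

By the sparse Riesz condition `‖v₄‖²` is at least `lam² |A ∩ A₀| / (c^* n)` when `|g_j| = lam` on
`A ∩ A₀`. With `A ⊇ A₀ᶜ` this bounds `|A|` by `M₁^* q` (`dimension_le_of_energy`), and with `A` the
active set itself it bounds the bias and the missed coefficients (`bias_sq_le_of_energy`,
`missed_sq_le_of_energy`).

**Continuation** (`card_selected_union_lt`). The energy inequality needs `|A| ≤ q^*` in advance.
For large `lam` the LASSO vanishes, and as `lam` decreases the fit is continuous. No model between
the active set and the equicorrelation set `{j | |g_j| = lam}`, augmented by `A₀ᶜ`, can have exactly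
`q^*` elements, since the dimension bound gives `M₁^* q ≤ q^* - 1`; hence the sizes never reach
`q^*`.

**Noise** (`noiseSet`, `probBound_le_stdGaussian_noiseSet`). The vector `v₄` is a multiple of a
vector determined by `A` and a sign vector `s` with entries `-1, 0, 1`, and it is orthogonal to
`(I - P_A) X β`, which depends on `A` only. So for all `lam` at once the noise term is controlled by
the projection of `ε / σ` onto a plane determined by `(A, s)`, whose squared norm exceeds `t` with
probability at most `exp (-t / 2)`. As `s` and `-s` give the same plane, there are `(3 ^ m - 1) / 2`
planes for a model of size `m ≥ 1`, and the sum of the resulting bounds is small enough whenever the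
claimed probability is positive. No set `A₀` enters, so that one event serves all of them.
-/

/-! ### Tails of planar Gaussian projections -/

namespace Lasso

lemma lintegral_Ioi_mul_exp_neg_sq {t : ℝ} (ht : 0 ≤ t) :
    ∫⁻ r in Set.Ioi √t, ENNReal.ofReal (r * Real.exp (-(r ^ 2 / 2)))
      = ENNReal.ofReal (Real.exp (-(t / 2))) := by
  have hderiv : ∀ x ∈ Set.Ici √t,
      HasDerivAt (fun r : ℝ => -Real.exp (-(r ^ 2 / 2))) (x * Real.exp (-(x ^ 2 / 2))) x := by
    intro x _
    have h1 : HasDerivAt (fun r : ℝ => -(r ^ 2 / 2)) (-x) x :=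
      (((hasDerivAt_pow 2 x).div_const 2).fun_neg).congr_deriv (by norm_num)
    exact h1.exp.fun_neg.congr_deriv (by ring)
  have hpos : ∀ x ∈ Set.Ioi √t, 0 ≤ x * Real.exp (-(x ^ 2 / 2)) := fun x hx =>
    mul_nonneg ((Real.sqrt_nonneg t).trans (le_of_lt hx)) (Real.exp_nonneg _)
  have hlim : Tendsto (fun r : ℝ => -Real.exp (-(r ^ 2 / 2))) atTop (𝓝 0) := by
    have h2 : Tendsto (fun r : ℝ => r ^ 2 / 2) atTop atTop :=
      (tendsto_pow_atTop two_ne_zero).atTop_div_const two_pos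
    simpa using (Real.tendsto_exp_neg_atTop_nhds_zero.comp h2).neg
  have hint := integrableOn_Ioi_deriv_of_nonneg' hderiv hpos hlim
  rw [← ofReal_integral_eq_lintegral_ofReal hint
    ((ae_restrict_iff' measurableSet_Ioi).2 (ae_of_all _ hpos)),
    integral_Ioi_of_hasDerivAt_of_nonneg' hderiv hpos hlim, Real.sq_sqrt ht]
  simp

/-- The squared norm of a standard Gaussian vector in the plane has the exponential tail
`exp (-t / 2)`, without any constant in front. -/
lemma gaussianReal_prod_sq_add_sq_gt {t : ℝ} (ht : 0 ≤ t) :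
    ((gaussianReal 0 1).prod (gaussianReal 0 1)) {x : ℝ × ℝ | t < x.1 ^ 2 + x.2 ^ 2}
      = ENNReal.ofReal (Real.exp (-(t / 2))) := by
  have hS : MeasurableSet {x : ℝ × ℝ | t < x.1 ^ 2 + x.2 ^ 2} :=
    measurableSet_lt (by fun_prop) (by fun_prop)
  rw [gaussianReal_of_var_ne_zero _ one_ne_zero,
    prod_withDensity (measurable_gaussianPDF 0 1) (measurable_gaussianPDF 0 1),
    withDensity_apply _ hS, ← lintegral_indicator hS, ← Measure.volume_eq_prod,
    ← lintegral_comp_polarCoord_symm]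
  have hrw : ∀ x ∈ polarCoord.target,
      ENNReal.ofReal x.1 • Set.indicator {x : ℝ × ℝ | t < x.1 ^ 2 + x.2 ^ 2}
          (fun z : ℝ × ℝ => gaussianPDF 0 1 z.1 * gaussianPDF 0 1 z.2) (polarCoord.symm x)
        = Set.indicator (Set.Ioi √t)
            (fun r => ENNReal.ofReal (r * Real.exp (-(r ^ 2 / 2)))) x.1
          * ENNReal.ofReal ((2 * Real.pi)⁻¹) := by
    rintro ⟨r, θ⟩ hx
    have hr : 0 < r := by
      simp only [polarCoord_target, Set.mem_prod, Set.mem_Ioi] at hx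
      exact hx.1
    have hsq : (r * Real.cos θ) ^ 2 + (r * Real.sin θ) ^ 2 = r ^ 2 := by
      rw [mul_pow, mul_pow, ← mul_add, Real.cos_sq_add_sin_sq, mul_one]
    have hiff : t < r ^ 2 ↔ √t < r := (Real.sqrt_lt' hr).symm
    simp only [polarCoord_symm_apply, Set.indicator_apply, Set.mem_ofPred_eq, hsq, Set.mem_Ioi,
      hiff]
    split_ifs with h
    · rw [gaussianPDF, gaussianPDF, ← ENNReal.ofReal_mul (gaussianPDFReal_nonneg _ _ _),
        smul_eq_mul, ← ENNReal.ofReal_mul hr.le, ← ENNReal.ofReal_mul (by positivity)]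
      congr 1
      simp only [gaussianPDFReal, NNReal.coe_one, mul_one, sub_zero]
      have hpi : (√(2 * Real.pi))⁻¹ * (√(2 * Real.pi))⁻¹ = (2 * Real.pi)⁻¹ := by
        rw [← mul_inv, Real.mul_self_sqrt (by positivity)]
      calc _ = ((√(2 * Real.pi))⁻¹ * (√(2 * Real.pi))⁻¹) * (r *
            (Real.exp (-(r * Real.cos θ) ^ 2 / 2) * Real.exp (-(r * Real.sin θ) ^ 2 / 2))) := by
            ring
        _ = _ := by
          rw [hpi, ← Real.exp_add, ← add_div, ← neg_add, hsq]
          ring_nf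
    · simp
  rw [setLIntegral_congr_fun polarCoord.open_target.measurableSet hrw, polarCoord_target,
    Measure.volume_eq_prod, ← Measure.prod_restrict,
    lintegral_prod_mul (f := Set.indicator (Set.Ioi √t)
      fun r => ENNReal.ofReal (r * Real.exp (-(r ^ 2 / 2))))
      (g := fun _ => ENNReal.ofReal ((2 * Real.pi)⁻¹))
      ((by fun_prop : Measurable fun r : ℝ =>
        ENNReal.ofReal (r * Real.exp (-(r ^ 2 / 2)))).indicator
          measurableSet_Ioi).aemeasurable aemeasurable_const,
    setLIntegral_indicator measurableSet_Ioi,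
    Set.inter_eq_left.2 (Set.Ioi_subset_Ioi (Real.sqrt_nonneg t)),
    lintegral_Ioi_mul_exp_neg_sq ht, setLIntegral_const, Real.volume_Ioo,
    ← ENNReal.ofReal_mul (by positivity), ← ENNReal.ofReal_mul (Real.exp_nonneg _)]
  congr 1
  field_simp
  ring

open scoped RealInnerProductSpace

variable {F : Type*} [NormedAddCommGroup F] [InnerProductSpace ℝ F] [FiniteDimensional ℝ F]
  [MeasurableSpace F] [BorelSpace F]

lemma map_inner_stdGaussian (e : F) :
    (stdGaussian F).map (fun z => ⟪e, z⟫) = (gaussianReal 0 1).map (‖e‖ * ·) := by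
  have h : HasGaussianLaw (fun z : F => ⟪e, z⟫) (stdGaussian F) :=
    (IsGaussian.hasGaussianLaw_id (μ := stdGaussian F)).map (innerSL ℝ e)
  have hmean : ∫ z, ⟪e, z⟫ ∂(stdGaussian F) = 0 :=
    integral_strongDual_stdGaussian (innerSL ℝ e)
  have hvar : Var[fun z => ⟪e, z⟫; stdGaussian F] = ‖e‖ ^ 2 := by
    simpa using variance_dual_stdGaussian (innerSL ℝ e)
  rw [h.map_eq_gaussianReal, gaussianReal_map_const_mul, hmean, hvar, mul_zero, mul_one]
  congr 1
  exact Real.toNNReal_of_nonneg (sq_nonneg _)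

lemma map_inner_inner_stdGaussian {e f : F} (hef : ⟪e, f⟫ = 0) :
    (stdGaussian F).map (fun z => (⟪e, z⟫, ⟪f, z⟫))
      = ((gaussianReal 0 1).prod (gaussianReal 0 1)).map
          (fun x : ℝ × ℝ => (‖e‖ * x.1, ‖f‖ * x.2)) := by
  have h : HasGaussianLaw (fun z : F => (⟪e, z⟫, ⟪f, z⟫)) (stdGaussian F) :=
    (IsGaussian.hasGaussianLaw_id (μ := stdGaussian F)).map
      ((innerSL ℝ e).prod (innerSL ℝ f))
  have hcov : cov[fun z => ⟪e, z⟫, fun z => ⟪f, z⟫; stdGaussian F] = 0 := by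
    rw [← covarianceBilin_apply_eq_cov IsGaussian.memLp_two_id, covarianceBilin_stdGaussian]
    exact hef
  have hind := h.indepFun_of_covariance_eq_zero hcov
  rw [indepFun_iff_map_prod_eq_prod_map_map (by fun_prop) (by fun_prop)] at hind
  rw [hind, map_inner_stdGaussian, map_inner_stdGaussian,
    Measure.map_prod_map _ _ (by fun_prop) (by fun_prop)]
  rfl

/-- Orthogonal vectors of norm at most one, possibly zero: the projection of a standard Gaussian
vector onto a space of dimension at most two has a tail no heavier than in the plane. -/
lemma stdGaussian_inner_sq_add_inner_sq_gt_le {e f : F} (hef : ⟪e, f⟫ = 0) (he : ‖e‖ ≤ 1)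
    (hf : ‖f‖ ≤ 1) {t : ℝ} (ht : 0 ≤ t) :
    stdGaussian F {z | t < ⟪e, z⟫ ^ 2 + ⟪f, z⟫ ^ 2} ≤ ENNReal.ofReal (Real.exp (-(t / 2))) := by
  have hS : MeasurableSet {x : ℝ × ℝ | t < x.1 ^ 2 + x.2 ^ 2} :=
    measurableSet_lt (by fun_prop) (by fun_prop)
  calc stdGaussian F {z | t < ⟪e, z⟫ ^ 2 + ⟪f, z⟫ ^ 2}
      = (stdGaussian F).map (fun z => (⟪e, z⟫, ⟪f, z⟫)) {x | t < x.1 ^ 2 + x.2 ^ 2} := by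
        rw [Measure.map_apply (by fun_prop) hS]
        rfl
    _ = ((gaussianReal 0 1).prod (gaussianReal 0 1))
          {x | t < (‖e‖ * x.1) ^ 2 + (‖f‖ * x.2) ^ 2} := by
        rw [map_inner_inner_stdGaussian hef, Measure.map_apply (by fun_prop) hS]
        rfl
    _ ≤ ((gaussianReal 0 1).prod (gaussianReal 0 1)) {x | t < x.1 ^ 2 + x.2 ^ 2} := by
        refine measure_mono fun x (hx : t < _) => lt_of_lt_of_le hx ?_
        rw [mul_pow, mul_pow]
        exact add_le_add
          (mul_le_of_le_one_left (sq_nonneg _) (pow_le_one₀ (norm_nonneg _) he))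
          (mul_le_of_le_one_left (sq_nonneg _) (pow_le_one₀ (norm_nonneg _) hf))
    _ = _ := gaussianReal_prod_sq_add_sq_gt ht

/-- Standardizing an isotropic Gaussian vector. -/
lemma hasLaw_inv_smul_stdGaussian {ι : Type*} [Fintype ι] [DecidableEq ι] {σ : ℝ} (hσ : 0 < σ)
    {Ω : Type*} [MeasurableSpace Ω] {P : Measure Ω} {ε : Ω → EuclideanSpace ℝ ι}
    (hε : HasLaw ε (multivariateGaussian 0 (σ ^ 2 • (1 : Matrix ι ι ℝ))) P) :
    HasLaw (fun ω => σ⁻¹ • ε ω) (stdGaussian (EuclideanSpace ℝ ι)) P := by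
  refine HasLaw.fun_comp (Y := fun z : EuclideanSpace ℝ ι => σ⁻¹ • z) ⟨by fun_prop, ?_⟩ hε
  have hS : (σ ^ 2 • (1 : Matrix ι ι ℝ)).PosSemidef := Matrix.PosSemidef.one.smul (sq_nonneg σ)
  apply Measure.ext_of_charFun
  ext t
  rw [charFun_map_smul, charFun_multivariateGaussian hS, charFun_stdGaussian]
  congr 1
  have : ((σ⁻¹ • t : EuclideanSpace ℝ ι) : ι → ℝ) ⬝ᵥ
      (σ ^ 2 • (1 : Matrix ι ι ℝ)).mulVec (σ⁻¹ • t : EuclideanSpace ℝ ι) = ‖t‖ ^ 2 := by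
    rw [EuclideanSpace.real_norm_sq_eq, Matrix.smul_mulVec, Matrix.one_mulVec, dotProduct]
    refine Finset.sum_congr rfl fun i _ => ?_
    simp
    field_simp
  rw [this]
  simp [neg_div]

end Lasso

/-! ### Dual vectors of a model and the energy inequality -/

namespace Lasso

open scoped RealInnerProductSpace

variable {n p : ℕ} {X : Matrix (Fin n) (Fin p) ℝ}

/-- The part `∑ j ∈ A, v j • x_j` of the fit carried by the model `A`. -/
noncomputable def subfit (X : Matrix (Fin n) (Fin p) ℝ) (A : Finset (Fin p)) (v : Fin p → ℝ) :
    E n :=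
  ∑ j ∈ A, v j • col X j

/-- The span of the design vectors `x_j`, `j ∈ A`. -/
def modelSpan (X : Matrix (Fin n) (Fin p) ℝ) (A : Finset (Fin p)) : Submodule ℝ (E n) :=
  Submodule.span ℝ (col X '' (A : Set (Fin p)))

/-- The part `(I - P_A) X β` of the mean vector that the model `A` misses. -/
noncomputable def missed (X : Matrix (Fin n) (Fin p) ℝ) (β : Fin p → ℝ) (A : Finset (Fin p)) :
    E n :=
  fit X β - (modelSpan X A).starProjection (fit X β)

/-- `u` is the vector of the span of the `x_j`, `j ∈ A`, whose inner products with these `x_j` are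
the prescribed numbers `h j`. When the `x_j`, `j ∈ A`, are independent this is
`X_A (X_Aᵀ X_A)⁻¹ h_A`; the values of `h` outside `A` are irrelevant. -/
def IsDual (X : Matrix (Fin n) (Fin p) ℝ) (A : Finset (Fin p)) (h : Fin p → ℝ) (u : E n) : Prop :=
  u ∈ modelSpan X A ∧ ∀ j ∈ A, ⟪col X j, u⟫ = h j

lemma bias_eq_norm_missed (X : Matrix (Fin n) (Fin p) ℝ) (β : Fin p → ℝ) (A : Finset (Fin p)) :
    bias X β A = ‖missed X β A‖ := rfl

lemma fit_eq_subfit_add_subfit_compl (X : Matrix (Fin n) (Fin p) ℝ) (β : Fin p → ℝ)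
    (A : Finset (Fin p)) : fit X β = subfit X A β + subfit X Aᶜ β :=
  (Finset.sum_add_sum_compl A _).symm

lemma fit_eq_subfit {b : Fin p → ℝ} {A : Finset (Fin p)} (hb : ∀ j ∉ A, b j = 0) :
    fit X b = subfit X A b := by
  rw [fit_eq_subfit_add_subfit_compl X b A, add_eq_left]
  exact Finset.sum_eq_zero fun j hj => by rw [hb j (Finset.mem_compl.1 hj), zero_smul]

lemma subfit_mem_modelSpan (A : Finset (Fin p)) (v : Fin p → ℝ) :
    subfit X A v ∈ modelSpan X A :=
  Submodule.sum_mem _ fun j hj => Submodule.smul_mem _ _ (Submodule.subset_span ⟨j, hj, rfl⟩)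

lemma mem_modelSpan_iff {A : Finset (Fin p)} {u : E n} :
    u ∈ modelSpan X A ↔ ∃ v : Fin p → ℝ, subfit X A v = u :=
  Submodule.mem_span_image_finset_iff_exists_fun' ℝ

lemma inner_subfit_left (A : Finset (Fin p)) (v : Fin p → ℝ) (u : E n) :
    ⟪subfit X A v, u⟫ = ∑ j ∈ A, v j * ⟪col X j, u⟫ := by
  simp only [subfit, sum_inner, real_inner_smul_left]

lemma subfit_union_of_disjoint {A B : Finset (Fin p)} (h : Disjoint A B) (v : Fin p → ℝ) :
    subfit X (A ∪ B) v = subfit X A v + subfit X B v :=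
  Finset.sum_union h

lemma subfit_add (A : Finset (Fin p)) (v w : Fin p → ℝ) :
    subfit X A (fun j => v j + w j) = subfit X A v + subfit X A w := by
  simp only [subfit, add_smul, Finset.sum_add_distrib]

lemma subfit_sub (A : Finset (Fin p)) (v w : Fin p → ℝ) :
    subfit X A (fun j => v j - w j) = subfit X A v - subfit X A w := by
  simp only [subfit, sub_smul, Finset.sum_sub_distrib]

lemma IsDual.unique {A : Finset (Fin p)} {h : Fin p → ℝ} {u u' : E n} (hu : IsDual X A h u)
    (hu' : IsDual X A h u') : u = u' := by
  have hmem : u - u' ∈ modelSpan X A := Submodule.sub_mem _ hu.1 hu'.1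
  obtain ⟨v, hv⟩ := mem_modelSpan_iff.1 hmem
  have h0 : ⟪u - u', u - u'⟫ = 0 := by
    nth_rewrite 1 [← hv]
    rw [inner_subfit_left]
    refine Finset.sum_eq_zero fun j hj => ?_
    rw [inner_sub_right, hu.2 j hj, hu'.2 j hj, sub_self, mul_zero]
  exact sub_eq_zero.1 (inner_self_eq_zero.1 h0)

lemma IsDual.add {A : Finset (Fin p)} {h h' : Fin p → ℝ} {u u' : E n} (hu : IsDual X A h u)
    (hu' : IsDual X A h' u') : IsDual X A (fun j => h j + h' j) (u + u') :=
  ⟨Submodule.add_mem _ hu.1 hu'.1, fun j hj => by rw [inner_add_right, hu.2 j hj, hu'.2 j hj]⟩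

lemma IsDual.smul {A : Finset (Fin p)} {h : Fin p → ℝ} {u : E n} (hu : IsDual X A h u) (c : ℝ) :
    IsDual X A (fun j => c * h j) (c • u) :=
  ⟨Submodule.smul_mem _ _ hu.1, fun j hj => by rw [real_inner_smul_right, hu.2 j hj]⟩

lemma IsDual.congr {A : Finset (Fin p)} {h h' : Fin p → ℝ} {u : E n} (hu : IsDual X A h u)
    (hh : ∀ j ∈ A, h j = h' j) : IsDual X A h' u :=
  ⟨hu.1, fun j hj => (hu.2 j hj).trans (hh j hj)⟩

lemma isDual_starProjection (A : Finset (Fin p)) (r : E n) :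
    IsDual X A (fun j => ⟪col X j, r⟫) ((modelSpan X A).starProjection r) := by
  refine ⟨Submodule.starProjection_apply_mem _ _, fun j hj => ?_⟩
  have h := Submodule.starProjection_inner_eq_zero (K := modelSpan X A) r (col X j)
    (Submodule.subset_span ⟨j, hj, rfl⟩)
  rw [real_inner_comm, inner_sub_right, sub_eq_zero] at h
  exact h.symm

lemma inner_missed_eq_zero (β : Fin p → ℝ) {A : Finset (Fin p)} {u : E n}
    (hu : u ∈ modelSpan X A) : ⟪missed X β A, u⟫ = 0 :=
  Submodule.starProjection_inner_eq_zero _ _ hu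

lemma IsDual.exists_of_lower {A : Finset (Fin p)} {k : ℝ} (hk : 0 < k)
    (hA : ∀ v : Fin p → ℝ, k * ∑ j ∈ A, v j ^ 2 ≤ ‖subfit X A v‖ ^ 2) (h : Fin p → ℝ) :
    ∃ u, IsDual X A h u := by
  classical
  let ext : (A → ℝ) →ₗ[ℝ] (Fin p → ℝ) :=
    { toFun := fun v j => if hj : j ∈ A then v ⟨j, hj⟩ else 0
      map_add' := fun v w => by ext j; by_cases hj : j ∈ A <;> simp [hj]
      map_smul' := fun c v => by ext j; by_cases hj : j ∈ A <;> simp [hj] }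
  let T : (A → ℝ) →ₗ[ℝ] (A → ℝ) :=
    { toFun := fun v i => ⟪col X i, subfit X A (ext v)⟫
      map_add' := fun v w => by
        ext i
        rw [map_add]
        change ⟪col X i, subfit X A (fun j => ext v j + ext w j)⟫ = _
        rw [subfit_add, inner_add_right]
        rfl
      map_smul' := fun c v => by
        ext i
        rw [map_smul]
        simp only [subfit, Pi.smul_apply, smul_eq_mul, mul_smul, ← Finset.smul_sum,
          real_inner_smul_right, RingHom.id_apply] }
  have hinj : Function.Injective T := by
    rw [← LinearMap.ker_eq_bot, LinearMap.ker_eq_bot']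
    intro v hv
    have h0 : ‖subfit X A (ext v)‖ ^ 2 = 0 := by
      rw [← real_inner_self_eq_norm_sq, inner_subfit_left]
      refine Finset.sum_eq_zero fun j hj => ?_
      have : T v ⟨j, hj⟩ = 0 := by rw [hv]; rfl
      rw [show ⟪col X j, subfit X A (ext v)⟫ = 0 from this, mul_zero]
    have h1 : ∑ j ∈ A, ext v j ^ 2 ≤ 0 := by
      have := hA (ext v)
      rw [h0] at this
      by_contra hcon
      push Not at hcon
      linarith [mul_pos hk hcon]
    have h2 := (Finset.sum_eq_zero_iff_of_nonneg fun j _ => sq_nonneg (ext v j)).1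
      (le_antisymm h1 (Finset.sum_nonneg fun j _ => sq_nonneg _))
    ext ⟨j, hj⟩
    have h3 := pow_eq_zero_iff (two_ne_zero) |>.1 (h2 j hj)
    simpa [ext, hj] using h3
  obtain ⟨v, hv⟩ := LinearMap.injective_iff_surjective.1 hinj fun i => h i
  exact ⟨_, subfit_mem_modelSpan A (ext v), fun j hj => congrFun hv ⟨j, hj⟩⟩

lemma IsDual.sum_sq_le {A : Finset (Fin p)} {h : Fin p → ℝ} {u : E n} (hu : IsDual X A h u) {k : ℝ}
    (hk : 0 ≤ k) (hA : ∀ v : Fin p → ℝ, ‖subfit X A v‖ ^ 2 ≤ k * ∑ j ∈ A, v j ^ 2) :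
    ∑ j ∈ A, h j ^ 2 ≤ k * ‖u‖ ^ 2 := by
  have h1 : ∑ j ∈ A, h j ^ 2 = ⟪subfit X A h, u⟫ := by
    rw [inner_subfit_left]
    exact Finset.sum_congr rfl fun j hj => by rw [hu.2 j hj, sq]
  set S := ∑ j ∈ A, h j ^ 2 with hS
  have hS0 : 0 ≤ S := Finset.sum_nonneg fun j _ => sq_nonneg _
  have h2 : S ^ 2 ≤ k * ‖u‖ ^ 2 * S := by
    calc S ^ 2 ≤ (‖subfit X A h‖ * ‖u‖) ^ 2 := by
          rw [h1]
          exact pow_le_pow_left₀ (h1 ▸ hS0) (real_inner_le_norm _ _) 2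
      _ = ‖subfit X A h‖ ^ 2 * ‖u‖ ^ 2 := mul_pow _ _ _
      _ ≤ (k * S) * ‖u‖ ^ 2 := mul_le_mul_of_nonneg_right (hA h) (sq_nonneg _)
      _ = _ := by ring
  rcases hS0.eq_or_lt with h0 | h0
  · rw [← h0]
    exact mul_nonneg hk (sq_nonneg _)
  · exact le_of_mul_le_mul_right (by rw [← sq]; exact h2) h0

lemma IsDual.le_sum_sq {A : Finset (Fin p)} {h : Fin p → ℝ} {u : E n} (hu : IsDual X A h u) {k : ℝ}
    (hk : 0 < k) (hA : ∀ v : Fin p → ℝ, k * ∑ j ∈ A, v j ^ 2 ≤ ‖subfit X A v‖ ^ 2) :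
    k * ‖u‖ ^ 2 ≤ ∑ j ∈ A, h j ^ 2 := by
  obtain ⟨v, hv⟩ := mem_modelSpan_iff.1 hu.1
  have h1 : ‖u‖ ^ 2 = ∑ j ∈ A, v j * h j := by
    rw [← real_inner_self_eq_norm_sq]
    nth_rewrite 1 [← hv]
    rw [inner_subfit_left]
    exact Finset.sum_congr rfl fun j hj => by rw [hu.2 j hj]
  have h2 : (‖u‖ ^ 2) ^ 2 ≤ (∑ j ∈ A, v j ^ 2) * ∑ j ∈ A, h j ^ 2 := by
    rw [h1]
    exact Finset.sum_mul_sq_le_sq_mul_sq A v h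
  have h3 := hA v
  rw [hv] at h3
  have hh : 0 ≤ ∑ j ∈ A, h j ^ 2 := Finset.sum_nonneg fun j _ => sq_nonneg _
  rcases (sq_nonneg ‖u‖).eq_or_lt with h0 | h0
  · rw [← h0, mul_zero]; exact hh
  · refine le_of_mul_le_mul_right ?_ h0
    calc k * ‖u‖ ^ 2 * ‖u‖ ^ 2 = k * (‖u‖ ^ 2) ^ 2 := by ring
      _ ≤ k * ((∑ j ∈ A, v j ^ 2) * ∑ j ∈ A, h j ^ 2) := mul_le_mul_of_nonneg_left h2 hk.le
      _ = (k * ∑ j ∈ A, v j ^ 2) * ∑ j ∈ A, h j ^ 2 := by ring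
      _ ≤ ‖u‖ ^ 2 * ∑ j ∈ A, h j ^ 2 := mul_le_mul_of_nonneg_right h3 hh
      _ = _ := mul_comm _ _

/-- The sparse Riesz condition of rank `qs` passes to all models of size at most `qs`. -/
lemma SparseRiesz.of_card_le {qs : ℕ} {cL cU : ℝ} (h : SparseRiesz X qs cL cU)
    {A : Finset (Fin p)} (hA : A.card ≤ qs) (v : Fin p → ℝ) :
    cL * n * ∑ j ∈ A, v j ^ 2 ≤ ‖subfit X A v‖ ^ 2 ∧
      ‖subfit X A v‖ ^ 2 ≤ cU * n * ∑ j ∈ A, v j ^ 2 := by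
  classical
  obtain ⟨B, hAB, hB⟩ := Finset.exists_superset_card_eq hA (by simpa using h.1)
  have key := h.2.2.2 B hB fun j => if j ∈ A then v j else 0
  have e1 : ∑ j ∈ B, (if j ∈ A then v j else 0) ^ 2 = ∑ j ∈ A, v j ^ 2 := by
    rw [← Finset.sum_subset hAB fun j _ hj => by simp [hj]]
    exact Finset.sum_congr rfl fun j hj => by rw [if_pos hj]
  have e2 : ∑ j ∈ B, (if j ∈ A then v j else 0) • col X j = subfit X A v := by
    rw [← Finset.sum_subset hAB fun j _ hj => by simp [hj]]
    exact Finset.sum_congr rfl fun j hj => by rw [if_pos hj]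
  rw [e1, e2, ← mul_assoc, ← mul_assoc] at key
  exact key

/-- The energy inequality. The part of the projected residual that comes from the active
coordinates in `A₀`, plus the missed part of the mean, is controlled by the noise in a single
direction and by quantities known in advance. -/
lemma energy_le {β b : Fin p → ℝ} {ε : E n} {lam : ℝ} {A A₀ : Finset (Fin p)} {g : Fin p → ℝ}
    (hg : ∀ j, g j = ⟪col X j, fit X β + ε - fit X b⟫) (hgl : ∀ j, |g j| ≤ lam)
    (hgb : ∀ j, g j * b j = lam * |b j|) (hb : ∀ j ∉ A, b j = 0) {v₃ v₄ : E n}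
    (h₃ : IsDual X A (fun j => if j ∈ A₀ then 0 else g j) v₃)
    (h₄ : IsDual X A (fun j => if j ∈ A₀ then g j else 0) v₄) :
    ‖v₄‖ ^ 2 + ‖missed X β A‖ ^ 2 ≤ ⟪v₄ - missed X β A, ε⟫ + ‖v₄‖ * ‖v₃‖
      + ‖subfit X Aᶜ β‖ * ‖v₃‖ + lam * (∑ j ∈ A ∩ A₀, |β j| + ∑ j ∈ Aᶜ, |β j|) := by
  set ω := missed X β A with hω
  set R := subfit X Aᶜ β with hR
  set P := (modelSpan X A).starProjection with hP
  set r := fit X β + ε - fit X b with hr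
  set D := subfit X A fun j => β j - b j with hD
  have hDmem : D ∈ modelSpan X A := subfit_mem_modelSpan _ _
  have hrD : r = D + R + ε := by
    rw [hr, hD, subfit_sub, ← fit_eq_subfit hb, fit_eq_subfit_add_subfit_compl X β A]
    abel
  have hPr : P r = v₃ + v₄ := by
    refine (isDual_starProjection A r).unique ((h₃.add h₄).congr fun j _ => ?_)
    by_cases hj : j ∈ A₀ <;> simp [hj, hg]
  have hRω : R = P R + ω := by
    rw [hω, missed, fit_eq_subfit_add_subfit_compl X β A, map_add,
      Submodule.starProjection_eq_self_iff.2 (subfit_mem_modelSpan A β)]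
    abel
  have hPR : P R ∈ modelSpan X A := Submodule.starProjection_apply_mem _ _
  have horth : ∀ u ∈ modelSpan X A, ⟪u, r⟫ = ⟪u, P r⟫ := fun u hu => by
    have := Submodule.starProjection_inner_eq_zero (K := modelSpan X A) r u hu
    rw [real_inner_comm, inner_sub_right, sub_eq_zero] at this
    exact this
  have hmiss : ∀ u ∈ modelSpan X A, ⟪ω, u⟫ = 0 := fun u hu => inner_missed_eq_zero β hu
  have e1 : ‖v₄‖ ^ 2 + ⟪v₄, v₃⟫ = ⟪v₄, D⟫ + ⟪v₄, R⟫ + ⟪v₄, ε⟫ := by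
    have := horth v₄ h₄.1
    rw [hPr, hrD, inner_add_right, inner_add_right, inner_add_right,
      real_inner_self_eq_norm_sq] at this
    linarith
  have e2 : ⟪R, r⟫ = ⟪R, v₃⟫ + ⟪v₄, R⟫ + ‖ω‖ ^ 2 + ⟪ω, ε⟫ := by
    have a1 : ⟪R, r⟫ = ⟪P R, r⟫ + ⟪ω, r⟫ := by rw [← inner_add_left, ← hRω]
    have a2 : ⟪R, P r⟫ = ⟪P R, P r⟫ := by
      nth_rewrite 1 [hRω]
      rw [inner_add_left, hmiss _ (Submodule.starProjection_apply_mem _ _), add_zero]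
    have a3 : ⟪ω, r⟫ = ‖ω‖ ^ 2 + ⟪ω, ε⟫ := by
      rw [hrD, hRω, inner_add_right, inner_add_right, inner_add_right, hmiss _ hDmem,
        hmiss _ hPR, real_inner_self_eq_norm_sq]
      ring
    rw [a1, horth _ hPR, ← a2, hPr, a3, inner_add_right, real_inner_comm R v₄]
    ring
  have e3 : ⟪v₄, D⟫ ≤ lam * ∑ j ∈ A ∩ A₀, |β j| := by
    rw [real_inner_comm, hD, inner_subfit_left, Finset.mul_sum,
      ← Finset.sum_filter_add_sum_filter_not A (fun j => j ∈ A₀), Finset.filter_mem_eq_inter]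
    rw [Finset.sum_eq_zero (s := A.filter fun j => j ∉ A₀) fun j hj => by
      rw [h₄.2 j (Finset.mem_filter.1 hj).1]; simp [(Finset.mem_filter.1 hj).2], add_zero]
    refine Finset.sum_le_sum fun j hj => ?_
    rw [h₄.2 j (Finset.mem_inter.1 hj).1]
    simp only [(Finset.mem_inter.1 hj).2, if_true]
    have b1 : 0 ≤ lam * |b j| := mul_nonneg ((abs_nonneg _).trans (hgl j)) (abs_nonneg _)
    have b2 : g j * β j ≤ lam * |β j| := (le_abs_self _).trans
      (by rw [abs_mul]; exact mul_le_mul_of_nonneg_right (hgl j) (abs_nonneg _))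
    linarith [hgb j, mul_comm (b j) (g j), mul_comm (β j) (g j), sub_mul (β j) (b j) (g j)]
  have e4 : ⟪R, r⟫ ≤ lam * ∑ j ∈ Aᶜ, |β j| := by
    rw [hR, inner_subfit_left, Finset.mul_sum]
    refine Finset.sum_le_sum fun j _ => ?_
    rw [← hg, mul_comm]
    exact (le_abs_self _).trans
      (by rw [abs_mul]; exact mul_le_mul_of_nonneg_right (hgl j) (abs_nonneg _))
  have e5 : -⟪v₄, v₃⟫ ≤ ‖v₄‖ * ‖v₃‖ := by
    rw [← inner_neg_left, ← norm_neg v₄]; exact real_inner_le_norm _ _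
  have e6 : -⟪R, v₃⟫ ≤ ‖R‖ * ‖v₃‖ := by
    rw [← inner_neg_left, ← norm_neg R]; exact real_inner_le_norm _ _
  rw [inner_sub_left]
  linarith

end Lasso

/-! ### The normalised energy inequality and its consequences -/

namespace Lasso

open scoped RealInnerProductSpace

/-- What is left of the normalised energy inequality when the noise term and the term linear in
`a` are absorbed into the squares on the left, using `m ≤ a² + x²`. -/
lemma sq_le_of_energy {a w z r R κ Q x y m : ℝ} (hxy : x ^ 2 + y ^ 2 = Q ^ 2) (hQ : 1 ≤ Q ^ 2)
    (hm : m ≤ a ^ 2 + x ^ 2)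
    (H : a ^ 2 + w ^ 2 ≤ 1 / 2 * √(max m 1) * √(a ^ 2 + w ^ 2) + a * (κ * x)
      + (κ * z + r * Q) * (κ * x) + (R * Q ^ 2 + y * (κ * z))) :
    3 / 4 * w ^ 2 ≤ Q ^ 2 / 4 + κ ^ 2 * x ^ 2 / 2 + R * Q ^ 2 + r * κ * Q * x
      + z * (κ ^ 2 * x + κ * y) := by
  have hM : max m 1 ≤ a ^ 2 + Q ^ 2 :=
    max_le (by nlinarith [sq_nonneg y]) (by nlinarith [sq_nonneg a])
  have h1 : √(max m 1) ^ 2 = max m 1 := Real.sq_sqrt (zero_le_one.trans (le_max_right _ _))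
  have h2 : √(a ^ 2 + w ^ 2) ^ 2 = a ^ 2 + w ^ 2 := Real.sq_sqrt (by positivity)
  nlinarith [sq_nonneg (√(max m 1) - √(a ^ 2 + w ^ 2)), sq_nonneg (a - κ * x)]

/-- The dimension bound in normalised form: here nothing of `A₀ᶜ` lies outside the model. -/
lemma dimension_le_of_energy {a w r R κ Q m : ℝ} (hm1 : 1 ≤ m) (hm : m ≤ a ^ 2 + Q ^ 2)
    (H : a ^ 2 + w ^ 2 ≤ 1 / 2 * √(max m 1) * √(a ^ 2 + w ^ 2) + a * (κ * Q)
      + r * Q * (κ * Q) + R * Q ^ 2) :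
    m ≤ (2 + 4 * R + 4 * κ * r + 4 * κ ^ 2) * Q ^ 2 := by
  rw [max_eq_left hm1] at H
  have h1 : √m ^ 2 = m := Real.sq_sqrt (by linarith)
  have h2 : √(a ^ 2 + w ^ 2) ^ 2 = a ^ 2 + w ^ 2 := Real.sq_sqrt (by positivity)
  nlinarith [sq_nonneg (√m - √(a ^ 2 + w ^ 2)), sq_nonneg (a - 2 * (κ * Q)), sq_nonneg w]

/-- The bias bound in normalised form. The excess of `z` over `w` is at most `r Q`, and the terms
linear in `w` are absorbed into `w ^ 2`. -/
lemma bias_sq_le_of_energy {w z r R κ Q x y : ℝ} (hκ : 1 ≤ κ) (hr : 0 ≤ r) (hQ : 0 ≤ Q)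
    (hx : 0 ≤ x) (hy : 0 ≤ y) (hxy : x ^ 2 + y ^ 2 = Q ^ 2) (hz : z ≤ w + r * Q)
    (H : 3 / 4 * w ^ 2 ≤ Q ^ 2 / 4 + κ ^ 2 * x ^ 2 / 2 + R * Q ^ 2 + r * κ * Q * x
      + z * (κ ^ 2 * x + κ * y)) :
    w ^ 2 ≤ 8 / 3 * (1 / 4 + R + r * (√2 * κ) * (1 + κ) + κ ^ 2 * (1 / 2 + 4 / 3 * κ ^ 2))
      * Q ^ 2 := by
  have hs2 : √2 ^ 2 = 2 := Real.sq_sqrt zero_le_two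
  have hs : 0 ≤ √2 := Real.sqrt_nonneg 2
  have hκ0 : 0 ≤ κ := zero_le_one.trans hκ
  have hxQ : x ≤ Q := abs_le_of_sq_le_sq' (by nlinarith) hQ |>.2
  -- the coefficient `κ² x + κ y` of `z` is bounded through `x + y ≤ √2 Q`, using `κ ≤ κ²`
  have hD0 : 0 ≤ κ ^ 2 * x + κ * y := by positivity
  have hxy2 : x + y ≤ √2 * Q :=
    abs_le_of_sq_le_sq' (by nlinarith [sq_nonneg (x - y)]) (by positivity) |>.2
  have hκκ : κ ≤ κ ^ 2 := by nlinarith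
  have hD1 : κ ^ 2 * x + κ * y ≤ κ ^ 2 * (√2 * Q) :=
    calc κ ^ 2 * x + κ * y ≤ κ ^ 2 * x + κ ^ 2 * y := by
          linarith [mul_le_mul_of_nonneg_right hκκ hy]
      _ = κ ^ 2 * (x + y) := by ring
      _ ≤ _ := mul_le_mul_of_nonneg_left hxy2 (sq_nonneg κ)
  have hD2 : (κ ^ 2 * x + κ * y) ^ 2 ≤ 2 * κ ^ 4 * Q ^ 2 :=
    (pow_le_pow_left₀ hD0 hD1 2).trans (le_of_eq (by rw [mul_pow, mul_pow, hs2]; ring))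
  have hs1 : 1 ≤ √2 := Real.one_le_sqrt.2 one_le_two
  have hD3 : κ * x + (κ ^ 2 * x + κ * y) ≤ √2 * κ * (1 + κ) * Q :=
    calc κ * x + (κ ^ 2 * x + κ * y) = κ * (x + y) + κ ^ 2 * x := by ring
      _ ≤ κ * (√2 * Q) + κ ^ 2 * (√2 * Q) :=
        add_le_add (mul_le_mul_of_nonneg_left hxy2 hκ0)
          (mul_le_mul_of_nonneg_left (by nlinarith) (sq_nonneg κ))
      _ = _ := by ring
  have h1 := mul_le_mul_of_nonneg_right hz hD0
  have h2 := mul_le_mul_of_nonneg_left hD3 (mul_nonneg hr hQ)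
  have h3 : κ ^ 2 * x ^ 2 ≤ κ ^ 2 * Q ^ 2 :=
    mul_le_mul_of_nonneg_left (pow_le_pow_left₀ hx hxQ 2) (sq_nonneg κ)
  have h4 := sq_nonneg (3 * w - 4 * (κ ^ 2 * x + κ * y))
  have e : r * κ * Q * x + r * Q * (κ ^ 2 * x + κ * y)
      = r * Q * (κ * x + (κ ^ 2 * x + κ * y)) := by ring
  nlinarith

/-- The bound on the missed coefficients in normalised form, with `D = √(1 + C)`. -/
lemma missed_sq_le_of_energy {w z r R κ Q x y D : ℝ} (hκ : 0 ≤ κ) (hr : 0 ≤ r) (hQ : 0 ≤ Q)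
    (hx : 0 ≤ x) (hz0 : 0 ≤ z) (hD : 0 ≤ D) (hDD : D ^ 2 = 1 + κ ^ 2)
    (hxy : x ^ 2 + y ^ 2 = Q ^ 2) (hz : z ≤ w + r * Q)
    (H : 3 / 4 * w ^ 2 ≤ Q ^ 2 / 4 + κ ^ 2 * x ^ 2 / 2 + R * Q ^ 2 + r * κ * Q * x
      + z * (κ ^ 2 * x + κ * y)) :
    z ^ 2 ≤ 8 / 3 * (1 / 4 + R + r * κ * (1 + 2 * D) + 3 * r ^ 2 / 4
      + κ ^ 2 * (7 / 6 + 2 / 3 * κ ^ 2)) * Q ^ 2 := by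
  have hxQ : x ≤ Q := abs_le_of_sq_le_sq' (by nlinarith) hQ |>.2
  have hC : κ ^ 2 * x + κ * y ≤ κ * D * Q := by
    refine abs_le_of_sq_le_sq' ?_ (by positivity) |>.2
    rw [mul_pow, mul_pow, hDD, ← hxy]
    nlinarith [sq_nonneg (κ * (x - κ * y))]
  have h1 := mul_le_mul_of_nonneg_left hC hz0
  have h2 := mul_le_mul_of_nonneg_right hz (by positivity : 0 ≤ κ * D * Q)
  have h3 : κ ^ 2 * x ^ 2 ≤ κ ^ 2 * Q ^ 2 :=
    mul_le_mul_of_nonneg_left (pow_le_pow_left₀ hx hxQ 2) (sq_nonneg κ)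
  have h4 : r * κ * Q * x ≤ r * κ * Q * Q := mul_le_mul_of_nonneg_left hxQ (by positivity)
  have h5 : z ^ 2 ≤ (w + r * Q) ^ 2 := pow_le_pow_left₀ hz0 hz 2
  have hκD : (κ * D) ^ 2 = κ ^ 2 * (1 + κ ^ 2) := by rw [mul_pow, hDD]
  -- the constant is the value for which the remaining quadratic form in `w` is a perfect square
  have h6 := sq_nonneg (w - 4 / 3 * (κ * D + 3 / 4 * r) * Q)
  have e6 : (w - 4 / 3 * (κ * D + 3 / 4 * r) * Q) ^ 2
      = w ^ 2 - 8 / 3 * w * (κ * D * Q) - 2 * w * (r * Q)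
        + (16 / 9 * (κ ^ 2 * (1 + κ ^ 2)) + 8 / 3 * (κ * D) * r + r ^ 2) * Q ^ 2 := by
    rw [← hκD]; ring
  rw [e6] at h6
  nlinarith

variable {n p : ℕ} {X : Matrix (Fin n) (Fin p) ℝ}

lemma norm_subfit_le_eta₂ (β : Fin p → ℝ) {A A₀ : Finset (Fin p)} (hA : A ⊆ A₀) :
    ‖subfit X A β‖ ≤ eta₂ X β A₀ :=
  Finset.le_sup' (fun A => ‖∑ j ∈ A, β j • col X j‖) (Finset.mem_powerset.2 hA)

lemma norm_sub_starProjection_le (K : Submodule ℝ (E n)) (u : E n) :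
    ‖u - K.starProjection u‖ ≤ ‖u‖ := by
  rw [← Submodule.starProjection_orthogonal_val]
  exact Submodule.norm_starProjection_apply_le _ _

/-- Projecting out the model `A` cannot shrink the fit of a disjoint set of coefficients below
the lower sparse Riesz bound. -/
lemma SparseRiesz.le_norm_sub_starProjection {qs : ℕ} {cL cU : ℝ} (h : SparseRiesz X qs cL cU)
    {A B : Finset (Fin p)} (hAB : Disjoint B A) (hc : (B ∪ A).card ≤ qs) (v : Fin p → ℝ) :
    cL * n * ∑ j ∈ B, v j ^ 2
      ≤ ‖subfit X B v - (modelSpan X A).starProjection (subfit X B v)‖ ^ 2 := by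
  classical
  obtain ⟨u, hu⟩ := mem_modelSpan_iff.1
    (Submodule.starProjection_apply_mem (modelSpan X A) (subfit X B v))
  have key := (h.of_card_le hc fun j => if j ∈ B then v j else -u j).1
  have e1 : subfit X (B ∪ A) (fun j => if j ∈ B then v j else -u j)
      = subfit X B v - subfit X A u := by
    rw [subfit_union_of_disjoint hAB, sub_eq_add_neg]
    congr 1
    · exact Finset.sum_congr rfl fun j hj => by simp only [hj, if_true]
    · rw [subfit, subfit, ← Finset.sum_neg_distrib]
      exact Finset.sum_congr rfl fun j hj => by
        simp only [Finset.disjoint_right.1 hAB hj, if_false, neg_smul]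
  have e2 : ∑ j ∈ B, v j ^ 2 ≤ ∑ j ∈ B ∪ A, (if j ∈ B then v j else -u j) ^ 2 := by
    rw [Finset.sum_congr rfl fun j hj => (by rw [if_pos hj] :
      v j ^ 2 = (if j ∈ B then v j else -u j) ^ 2)]
    exact Finset.sum_le_sum_of_subset_of_nonneg Finset.subset_union_left
      fun _ _ _ => sq_nonneg _
  rw [e1, hu] at key
  exact (mul_le_mul_of_nonneg_left e2
    (mul_nonneg h.2.1.le (Nat.cast_nonneg n))).trans key

/-- The unit `lam / √(c^* n)` in which vectors of `ℝⁿ` are measured. -/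
noncomputable def scale (n : ℕ) (cU lam : ℝ) : ℝ := lam / √(cU * n)

lemma scale_pos {cU lam : ℝ} (hn : 1 ≤ n) (hcU : 0 < cU) (hl : 0 < lam) : 0 < scale n cU lam := by
  have : (0 : ℝ) < n := by exact_mod_cast hn
  exact div_pos hl (Real.sqrt_pos.2 (by positivity))

lemma scale_sq {cU lam : ℝ} (hcU : 0 < cU) : scale n cU lam ^ 2 = lam ^ 2 / (cU * n) := by
  rw [scale, div_pow, Real.sq_sqrt (by positivity)]

lemma r₂_mul_scale {q : ℕ} {cU η₂ lam : ℝ} (hn : 1 ≤ n) (hq : 1 ≤ q) (hcU : 0 < cU) (hl : 0 < lam)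
    (hη : 0 ≤ η₂) : r₂ n q cU η₂ lam * √q * scale n cU lam = η₂ := by
  have hn' : (0 : ℝ) < n := by exact_mod_cast hn
  have hq' : (0 : ℝ) < q := by exact_mod_cast hq
  have h : cU * η₂ ^ 2 * n / (q * lam ^ 2) * q = (η₂ * √(cU * n) / lam) ^ 2 := by
    rw [div_pow, mul_pow, Real.sq_sqrt (by positivity)]
    field_simp
  have hs : 0 < √(cU * n) := Real.sqrt_pos.2 (by positivity)
  rw [r₂, ← Real.sqrt_mul (by positivity), h, Real.sqrt_sq (by positivity), scale]
  field_simp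

lemma r₁_sq_mul_scale_sq {q : ℕ} {cU η₁ lam : ℝ} (hn : 1 ≤ n) (hq : 1 ≤ q) (hcU : 0 < cU)
    (hl : 0 < lam) (hη : 0 ≤ η₁) :
    r₁ n q cU η₁ lam ^ 2 * q * scale n cU lam ^ 2 = lam * η₁ := by
  have hn' : (0 : ℝ) < n := by exact_mod_cast hn
  have hq' : (0 : ℝ) < q := by exact_mod_cast hq
  rw [r₁, Real.sq_sqrt (by positivity), scale_sq hcU]
  field_simp

/-- The energy inequality in units of `scale`, under the sparsity and sparse Riesz conditions. Here
`w` stands for the missed part of the mean, `z` for the coefficients of `A₀ᶜ` outside the model, `a`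
for the dual vector of the active coordinates in `A₀`, and `x² + y² = Q² = q` splits `A₀ᶜ` into its
parts inside and outside the model. -/
lemma normalized_energy {β b : Fin p → ℝ} {ε : E n} {lam : ℝ} {A A₀ : Finset (Fin p)}
    {g : Fin p → ℝ} {q qs : ℕ} {cL cU η₁ : ℝ} (hn : 1 ≤ n) (hq : 1 ≤ q) (hsp : Sparse β A₀ q η₁)
    (hR : SparseRiesz X qs cL cU) (hl : 0 < lam)
    (hg : ∀ j, g j = ⟪col X j, fit X β + ε - fit X b⟫) (hgl : ∀ j, |g j| ≤ lam)
    (hgb : ∀ j, g j * b j = lam * |b j|) (hb : ∀ j ∉ A, b j = 0)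
    (hgA : ∀ j ∈ A ∩ A₀, |g j| = lam) (hc : (A ∪ A₀ᶜ).card ≤ qs)
    (hnoise : ∀ v, IsDual X A (fun j => if j ∈ A₀ then g j else 0) v →
      ⟪v - missed X β A, ε⟫ ≤ 1 / 2 * scale n cU lam * √(max (A.card : ℝ) 1)
        * √(‖v‖ ^ 2 + ‖missed X β A‖ ^ 2))
    {w z r κ x y Q R : ℝ} (hw : w = ‖missed X β A‖ / scale n cU lam)
    (hz : z = √(cL * n * ∑ j ∈ A₀ᶜ \ A, β j ^ 2) / scale n cU lam)
    (hr : r = r₂ n q cU (eta₂ X β A₀) lam) (hκ : κ = √(cU / cL)) (hQ : Q = √q)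
    (hx : x = √((A \ A₀).card : ℝ)) (hy : y = √((A₀ᶜ \ A).card : ℝ))
    (hRR : R = r₁ n q cU η₁ lam ^ 2) :
    z ≤ w + r * Q ∧ ∃ a : ℝ, (A.card : ℝ) ≤ a ^ 2 + x ^ 2 ∧
      a ^ 2 + w ^ 2 ≤ 1 / 2 * √(max (A.card : ℝ) 1) * √(a ^ 2 + w ^ 2) + a * (κ * x)
        + (κ * z + r * Q) * (κ * x) + (R * Q ^ 2 + y * (κ * z)) := by
  have hn' : (0 : ℝ) < n := by exact_mod_cast hn
  have hq' : (0 : ℝ) < q := by exact_mod_cast hq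
  have hcL : 0 < cL := hR.2.1
  have hcU : 0 < cU := hcL.trans hR.2.2.1
  have hτ : 0 < scale n cU lam := scale_pos hn hcU hl
  set τ := scale n cU lam with hτdef
  have hη₂ : 0 ≤ eta₂ X β A₀ := (norm_nonneg _).trans
    (norm_subfit_le_eta₂ (X := X) β (Finset.Subset.refl A₀))
  have hη₁ : 0 ≤ η₁ := (Finset.sum_nonneg fun j _ => abs_nonneg _).trans hsp.2
  have hrτ : r * Q * τ = eta₂ X β A₀ := by rw [hr, hQ]; exact r₂_mul_scale hn hq hcU hl hη₂
  have hRτ : R * Q ^ 2 * τ ^ 2 = lam * η₁ := by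
    rw [hRR, hQ, Real.sq_sqrt hq'.le]; exact r₁_sq_mul_scale_sq hn hq hcU hl hη₁
  have hwτ : ‖missed X β A‖ = τ * w := by rw [hw, mul_comm, div_mul_cancel₀ _ hτ.ne']
  have hzτ : √(cL * n * ∑ j ∈ A₀ᶜ \ A, β j ^ 2) = τ * z := by
    rw [hz, mul_comm τ, div_mul_cancel₀ _ hτ.ne']
  have hκ0 : 0 ≤ κ := hκ ▸ Real.sqrt_nonneg _
  have hx0 : 0 ≤ x := hx ▸ Real.sqrt_nonneg _
  have hy0 : 0 ≤ y := hy ▸ Real.sqrt_nonneg _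
  have hκ2 : κ ^ 2 = cU / cL := by rw [hκ, Real.sq_sqrt (by positivity)]
  have hx2 : x ^ 2 = ((A \ A₀).card : ℝ) := by rw [hx, Real.sq_sqrt (Nat.cast_nonneg _)]
  have hy2 : y ^ 2 = ((A₀ᶜ \ A).card : ℝ) := by rw [hy, Real.sq_sqrt (Nat.cast_nonneg _)]
  have hτ2 : cU * n * τ ^ 2 = lam ^ 2 := by
    rw [hτdef, scale_sq hcU, mul_comm, div_mul_cancel₀ _ (by positivity)]
  have hκL : cL * κ ^ 2 = cU := by rw [hκ2, mul_comm, div_mul_cancel₀ _ hcL.ne']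
  have hS0 : 0 ≤ ∑ j ∈ A₀ᶜ \ A, β j ^ 2 := Finset.sum_nonneg fun j _ => sq_nonneg _
  have hz0 : 0 ≤ z := by rw [hz]; positivity
  have hzz : τ ^ 2 * z ^ 2 = cL * n * ∑ j ∈ A₀ᶜ \ A, β j ^ 2 := by
    rw [← mul_pow, ← hzτ, Real.sq_sqrt (by positivity)]
  have hcA : A.card ≤ qs := (Finset.card_le_card Finset.subset_union_left).trans hc
  have hlow := fun v => (hR.of_card_le hcA v).1
  have hupp := fun v => (hR.of_card_le hcA v).2
  have hAc : Aᶜ = (A₀ \ A) ∪ (A₀ᶜ \ A) := by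
    ext j
    simp only [Finset.mem_compl, Finset.mem_union, Finset.mem_sdiff]
    tauto
  have hdisj : Disjoint (A₀ \ A) (A₀ᶜ \ A) := by
    rw [Finset.disjoint_left]
    intro j h1 h2
    exact (Finset.mem_compl.1 (Finset.mem_sdiff.1 h2).1) (Finset.mem_sdiff.1 h1).1
  have hRc : subfit X Aᶜ β = subfit X (A₀ \ A) β + subfit X (A₀ᶜ \ A) β := by
    rw [hAc, subfit_union_of_disjoint hdisj]
  have hη : ‖subfit X (A₀ \ A) β‖ ≤ τ * (r * Q) := by
    rw [mul_comm, hrτ]; exact norm_subfit_le_eta₂ β Finset.sdiff_subset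
  -- the coefficients of `A₀ᶜ` outside the model
  have h5 : ‖subfit X (A₀ᶜ \ A) β‖ ≤ τ * (κ * z) := by
    have hc5 : (A₀ᶜ \ A).card ≤ qs := (Finset.card_le_card
      (Finset.sdiff_subset.trans Finset.subset_union_right)).trans hc
    refine abs_le_of_sq_le_sq' ?_ (by positivity) |>.2
    refine ((hR.of_card_le hc5 β).2).trans (le_of_eq ?_)
    rw [mul_pow, mul_pow, hκ2, mul_left_comm, hzz]
    field_simp
  have hzw : z ≤ w + r * Q := by
    have h1 : cL * n * ∑ j ∈ A₀ᶜ \ A, β j ^ 2 ≤ _ := hR.le_norm_sub_starProjection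
      (A := A) (B := A₀ᶜ \ A) Finset.sdiff_disjoint
      (by rw [Finset.sdiff_union_self_eq_union, Finset.union_comm]; exact hc) β
    have h2 : subfit X (A₀ᶜ \ A) β - (modelSpan X A).starProjection (subfit X (A₀ᶜ \ A) β)
        = missed X β A
          - (subfit X (A₀ \ A) β - (modelSpan X A).starProjection (subfit X (A₀ \ A) β)) := by
      rw [missed, fit_eq_subfit_add_subfit_compl X β A, hRc, map_add, map_add,
        Submodule.starProjection_eq_self_iff.2 (subfit_mem_modelSpan A β)]
      abel
    have h3 : τ * z ≤ τ * (w + r * Q) := by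
      rw [← hzτ]
      refine (Real.sqrt_le_sqrt h1).trans ?_
      rw [Real.sqrt_sq (norm_nonneg _), h2, mul_add, ← hwτ]
      exact (norm_sub_le _ _).trans
        (add_le_add le_rfl ((norm_sub_starProjection_le _ _).trans hη))
    exact le_of_mul_le_mul_left h3 hτ
  obtain ⟨v₃, h₃⟩ := IsDual.exists_of_lower (by positivity) hlow fun j => if j ∈ A₀ then 0 else g j
  obtain ⟨v₄, h₄⟩ := IsDual.exists_of_lower (by positivity) hlow fun j => if j ∈ A₀ then g j else 0
  have hv₄ : ‖v₄‖ = τ * (‖v₄‖ / τ) := by rw [mul_comm, div_mul_cancel₀ _ hτ.ne']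
  set a := ‖v₄‖ / τ with ha
  have ha0 : 0 ≤ a := by positivity
  have hcard : ((A ∩ A₀).card : ℝ) + ((A \ A₀).card : ℝ) = A.card := by
    exact_mod_cast Finset.card_inter_add_card_sdiff A A₀
  refine ⟨hzw, a, ?_, ?_⟩
  · have h1 := h₄.sum_sq_le (by positivity) hupp
    have h2 : ∑ j ∈ A, (if j ∈ A₀ then g j else 0) ^ 2 = (A ∩ A₀).card * lam ^ 2 := by
      simp only [ite_pow, ne_eq, OfNat.ofNat_ne_zero, not_false_eq_true, zero_pow]
      rw [← Finset.sum_filter, Finset.filter_mem_eq_inter, Finset.sum_congr rfl fun j hj => (by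
        rw [← sq_abs, hgA j hj] : g j ^ 2 = lam ^ 2), Finset.sum_const, nsmul_eq_mul]
    rw [h2, hv₄, mul_pow, ← mul_assoc, hτ2, mul_comm (lam ^ 2)] at h1
    have := le_of_mul_le_mul_right h1 (by positivity)
    rw [hx2]
    linarith
  · have hv₃ : ‖v₃‖ ≤ τ * (κ * x) := by
      have h1 := h₃.le_sum_sq (by positivity) hlow
      have h2 : ∑ j ∈ A, (if j ∈ A₀ then 0 else g j) ^ 2 ≤ (A \ A₀).card * lam ^ 2 := by
        simp only [ite_pow, ne_eq, OfNat.ofNat_ne_zero, not_false_eq_true, zero_pow]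
        rw [Finset.sum_ite, Finset.sum_const_zero, zero_add, Finset.sdiff_eq_filter,
          ← nsmul_eq_mul]
        exact Finset.sum_le_card_nsmul _ _ _ fun j _ => sq_le_sq.2
          ((hgl j).trans (le_abs_self _))
      refine abs_le_of_sq_le_sq' ?_ (by positivity) |>.2
      refine le_of_mul_le_mul_left (h1.trans (h2.trans (le_of_eq ?_)))
        (by positivity : 0 < cL * (n : ℝ))
      rw [mul_pow, mul_pow, hx2, ← hτ2, ← hκL]
      ring
    have hl1 : lam * (∑ j ∈ A ∩ A₀, |β j| + ∑ j ∈ Aᶜ, |β j|)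
        ≤ τ ^ 2 * (R * Q ^ 2 + y * (κ * z)) := by
      have s1 : ∑ j ∈ A ∩ A₀, |β j| + ∑ j ∈ Aᶜ, |β j|
          = ∑ j ∈ A₀, |β j| + ∑ j ∈ A₀ᶜ \ A, |β j| := by
        rw [hAc, Finset.sum_union hdisj, ← add_assoc, Finset.inter_comm,
          Finset.sum_inter_add_sum_sdiff]
      have s2 : lam * ∑ j ∈ A₀ᶜ \ A, |β j| ≤ τ ^ 2 * (y * (κ * z)) := by
        refine abs_le_of_sq_le_sq' ?_ (by positivity) |>.2
        have s3 : (∑ j ∈ A₀ᶜ \ A, |β j|) ^ 2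
            ≤ (A₀ᶜ \ A).card * ∑ j ∈ A₀ᶜ \ A, β j ^ 2 := by
          simpa only [sq_abs] using
            sq_sum_le_card_mul_sum_sq (s := A₀ᶜ \ A) (f := fun j => |β j|)
        have s4 : (τ ^ 2 * (y * (κ * z))) ^ 2 = lam ^ 2 *
            ((A₀ᶜ \ A).card * ∑ j ∈ A₀ᶜ \ A, β j ^ 2) := by
          calc (τ ^ 2 * (y * (κ * z))) ^ 2 = τ ^ 2 * y ^ 2 * κ ^ 2 * (τ ^ 2 * z ^ 2) := by ring
            _ = _ := by rw [hzz, hy2, ← hτ2, ← hκL]; ring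
        rw [s4, mul_pow]
        exact mul_le_mul_of_nonneg_left s3 (sq_nonneg lam)
      rw [s1, mul_add, mul_add, mul_comm (τ ^ 2), hRτ]
      exact add_le_add (mul_le_mul_of_nonneg_left hsp.2 hl.le) s2
    have hRn : ‖subfit X Aᶜ β‖ ≤ τ * (κ * z + r * Q) := by
      rw [hRc, mul_add, add_comm (τ * _)]
      exact (norm_add_le _ _).trans (add_le_add hη h5)
    have hE := energy_le hg hgl hgb hb h₃ h₄
    have hN := hnoise v₄ h₄
    have hsq : √(‖v₄‖ ^ 2 + ‖missed X β A‖ ^ 2) = τ * √(a ^ 2 + w ^ 2) := by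
      rw [hwτ, hv₄, mul_pow, mul_pow, ← mul_add, Real.sqrt_mul (by positivity), Real.sqrt_sq hτ.le]
    rw [hsq] at hN
    have m1 : ‖v₄‖ * ‖v₃‖ ≤ τ * a * (τ * (κ * x)) := by
      rw [hv₄]; exact mul_le_mul_of_nonneg_left hv₃ (by positivity)
    have m2 : ‖subfit X Aᶜ β‖ * ‖v₃‖ ≤ τ * (κ * z + r * Q) * (τ * (κ * x)) :=
      mul_le_mul hRn hv₃ (norm_nonneg _) ((norm_nonneg _).trans hRn)
    have hfin : τ ^ 2 * (a ^ 2 + w ^ 2) ≤ τ ^ 2 * (1 / 2 * √(max (A.card : ℝ) 1) *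
        √(a ^ 2 + w ^ 2) + a * (κ * x) + (κ * z + r * Q) * (κ * x)
        + (R * Q ^ 2 + y * (κ * z))) := by
      calc τ ^ 2 * (a ^ 2 + w ^ 2) = ‖v₄‖ ^ 2 + ‖missed X β A‖ ^ 2 := by
            rw [hwτ, hv₄]; ring
        _ ≤ _ := hE
        _ ≤ 1 / 2 * τ * √(max (A.card : ℝ) 1) * (τ * √(a ^ 2 + w ^ 2)) + τ * a * (τ * (κ * x))
            + τ * (κ * z + r * Q) * (τ * (κ * x)) + τ ^ 2 * (R * Q ^ 2 + y * (κ * z)) :=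
          add_le_add (add_le_add (add_le_add hN m1) m2) hl1
        _ = _ := by ring
    exact le_of_mul_le_mul_left hfin (by positivity)

end Lasso

/-! ### First order conditions and continuation in the penalty level -/

namespace Lasso

open scoped RealInnerProductSpace

variable {n p : ℕ} {X : Matrix (Fin n) (Fin p) ℝ} {y : E n} {lam : ℝ} {b : Fin p → ℝ}

lemma mem_selected {j : Fin p} : j ∈ selected b ↔ b j ≠ 0 := by simp [selected]

lemma fit_add (v w : Fin p → ℝ) : fit X (v + w) = fit X v + fit X w := by
  simp only [fit, Pi.add_apply, add_smul, Finset.sum_add_distrib]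

lemma fit_smul (c : ℝ) (v : Fin p → ℝ) : fit X (c • v) = c • fit X v := by
  simp only [fit, Pi.smul_apply, smul_eq_mul, mul_smul, Finset.smul_sum]

lemma fit_sub (v w : Fin p → ℝ) : fit X (v - w) = fit X v - fit X w := by
  simp only [fit, Pi.sub_apply, sub_smul, Finset.sum_sub_distrib]

lemma fit_single (j : Fin p) (c : ℝ) : fit X (Pi.single j c) = c • col X j := by
  rw [fit, Finset.sum_eq_single j (fun k _ hk => by rw [Pi.single_eq_of_ne hk, zero_smul])
    (fun h => absurd (Finset.mem_univ j) h), Pi.single_eq_same]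

lemma fit_zero : fit X (0 : Fin p → ℝ) = 0 := by simp [fit]

lemma continuous_fit : Continuous (fit X) := by unfold fit; fun_prop

lemma objective_zero : objective X y lam 0 = ‖y‖ ^ 2 / 2 := by simp [objective, fit_zero]

/-- The first order condition of the LASSO in variational form, from minimality along the segment
from `b` to `b'`. -/
lemma IsLasso.inner_le (h : IsLasso X y lam b) (hl : 0 ≤ lam) (b' : Fin p → ℝ) :
    ⟪y - fit X b, fit X b' - fit X b⟫ ≤ lam * (∑ j, |b' j| - ∑ j, |b j|) := by
  set r := y - fit X b with hr
  set d := fit X b' - fit X b with hd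
  set Δ := lam * (∑ j, |b' j| - ∑ j, |b j|) with hΔ
  have key : ∀ t : ℝ, 0 < t → t ≤ 1 → ⟪r, d⟫ ≤ Δ + t * (‖d‖ ^ 2 / 2) := by
    intro t ht ht1
    have h1 := h (b + t • (b' - b))
    have h2 : y - fit X (b + t • (b' - b)) = r - t • d := by
      rw [fit_add, fit_smul, fit_sub, hr, hd]
      abel
    have h3 : ∑ j, |(b + t • (b' - b)) j| ≤ (1 - t) * ∑ j, |b j| + t * ∑ j, |b' j| := by
      rw [Finset.mul_sum, Finset.mul_sum, ← Finset.sum_add_distrib]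
      refine Finset.sum_le_sum fun j _ => ?_
      have : (b + t • (b' - b)) j = (1 - t) * b j + t * b' j := by
        simp only [Pi.add_apply, Pi.smul_apply, Pi.sub_apply, smul_eq_mul]; ring
      rw [this]
      refine (abs_add_le _ _).trans (le_of_eq ?_)
      rw [abs_mul, abs_mul, abs_of_pos ht, abs_of_nonneg (sub_nonneg.2 ht1)]
    have h4 := mul_le_mul_of_nonneg_left h3 hl
    simp only [objective] at h1
    rw [h2, ← hr, norm_sub_sq_real r, real_inner_smul_right, norm_smul, mul_pow, Real.norm_eq_abs,
      sq_abs] at h1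
    have h5 : t * ⟪r, d⟫ ≤ t * (Δ + t * (‖d‖ ^ 2 / 2)) := by
      rw [hΔ]
      nlinarith
    exact le_of_mul_le_mul_left h5 ht
  by_contra hcon
  push Not at hcon
  set δ := ⟪r, d⟫ - Δ with hδ
  have hδ0 : 0 < δ := sub_pos.2 hcon
  have hden : 0 < ‖d‖ ^ 2 + 1 := by positivity
  have h1 := key (min 1 (δ / (‖d‖ ^ 2 + 1))) (lt_min one_pos (div_pos hδ0 hden)) (min_le_left _ _)
  have h2 : min 1 (δ / (‖d‖ ^ 2 + 1)) * (‖d‖ ^ 2 + 1) ≤ δ :=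
    (mul_le_mul_of_nonneg_right (min_le_right _ _) hden.le).trans
      (le_of_eq (div_mul_cancel₀ _ hden.ne'))
  have h3 : 0 < min 1 (δ / (‖d‖ ^ 2 + 1)) := lt_min one_pos (div_pos hδ0 hden)
  nlinarith [sq_nonneg ‖d‖, mul_nonneg h3.le (sq_nonneg ‖d‖)]

lemma IsLasso.abs_inner_le (h : IsLasso X y lam b) (hl : 0 ≤ lam) (j : Fin p) :
    |⟪col X j, y - fit X b⟫| ≤ lam := by
  have key : ∀ c : ℝ, c * ⟪col X j, y - fit X b⟫ ≤ lam * |c| := by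
    intro c
    have h1 := h.inner_le hl (b + Pi.single j c)
    rw [fit_add, add_sub_cancel_left, fit_single, real_inner_smul_right, real_inner_comm] at h1
    refine h1.trans (mul_le_mul_of_nonneg_left ?_ hl)
    have h2 : ∑ k, |(b + Pi.single j c : Fin p → ℝ) k|
        ≤ ∑ k, (|b k| + |(Pi.single j c : Fin p → ℝ) k|) :=
      Finset.sum_le_sum fun k _ => abs_add_le _ _
    have h3 : ∑ k, |(Pi.single j c : Fin p → ℝ) k| = |c| := by
      rw [Finset.sum_eq_single j (fun k _ hk => by rw [Pi.single_eq_of_ne hk, abs_zero])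
        (fun h => absurd (Finset.mem_univ j) h), Pi.single_eq_same]
    rw [Finset.sum_add_distrib, h3] at h2
    linarith
  have h1 := key 1
  have h2 := key (-1)
  rw [abs_one] at h1
  rw [abs_neg, abs_one] at h2
  exact abs_le.2 ⟨by linarith, by linarith⟩

lemma IsLasso.inner_mul_eq (h : IsLasso X y lam b) (hl : 0 ≤ lam) (j : Fin p) :
    ⟪col X j, y - fit X b⟫ * b j = lam * |b j| := by
  refine le_antisymm ?_ ?_
  · refine (le_abs_self _).trans ?_
    rw [abs_mul]
    exact mul_le_mul_of_nonneg_right (h.abs_inner_le hl j) (abs_nonneg _)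
  · have h1 := h.inner_le hl (b + Pi.single j (-b j))
    rw [fit_add, add_sub_cancel_left, fit_single, real_inner_smul_right, real_inner_comm] at h1
    have h2 : ∑ k, |(b + Pi.single j (-b j) : Fin p → ℝ) k| = ∑ k, |b k| - |b j| := by
      rw [← Finset.add_sum_erase _ _ (Finset.mem_univ j),
        ← Finset.add_sum_erase (a := j) _ (fun k => |b k|) (Finset.mem_univ j),
        Pi.add_apply, Pi.single_eq_same, add_neg_cancel, abs_zero, zero_add, add_sub_cancel_left]
      refine Finset.sum_congr rfl fun k hk => ?_
      rw [Pi.add_apply, Pi.single_eq_of_ne (Finset.ne_of_mem_erase hk), add_zero]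
    rw [h2] at h1
    linarith

/-- The equicorrelation condition: active variables have correlation exactly `± lam` with the
residual. -/
lemma IsLasso.abs_inner_eq (h : IsLasso X y lam b) (hl : 0 ≤ lam) {j : Fin p}
    (hj : j ∈ selected b) : |⟪col X j, y - fit X b⟫| = lam := by
  have h1 := congrArg abs (h.inner_mul_eq hl j)
  rw [abs_mul, abs_mul, abs_abs, abs_of_nonneg hl] at h1
  exact mul_right_cancel₀ (abs_ne_zero.2 (mem_selected.1 hj)) h1

lemma IsLasso.sum_abs_le (h : IsLasso X y lam b) : lam * ∑ j, |b j| ≤ ‖y‖ ^ 2 / 2 := by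
  have h1 := h 0
  rw [objective_zero, objective] at h1
  nlinarith [sq_nonneg ‖y - fit X b‖]

lemma IsLasso.norm_residual_le (h : IsLasso X y lam b) (hl : 0 ≤ lam) : ‖y - fit X b‖ ≤ ‖y‖ := by
  have h1 := h 0
  rw [objective_zero, objective] at h1
  have h2 : 0 ≤ lam * ∑ j, |b j| := mul_nonneg hl (Finset.sum_nonneg fun j _ => abs_nonneg _)
  exact abs_le_of_sq_le_sq' (by linarith) (norm_nonneg y) |>.2

/-- Stability of the fit in the penalty level; for `lam = lam'` this is uniqueness of the fit. -/
lemma IsLasso.norm_fit_sub_sq_le (h : IsLasso X y lam b) (hl : 0 ≤ lam) {lam' : ℝ}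
    {b' : Fin p → ℝ} (h' : IsLasso X y lam' b') (hl' : 0 ≤ lam') :
    ‖fit X b' - fit X b‖ ^ 2 ≤ (lam - lam') * (∑ j, |b' j| - ∑ j, |b j|) := by
  have h1 := h.inner_le hl b'
  have h2 := h'.inner_le hl' b
  have h3 : ‖fit X b' - fit X b‖ ^ 2 = ⟪y - fit X b, fit X b' - fit X b⟫
      + ⟪y - fit X b', fit X b - fit X b'⟫ := by
    rw [← neg_sub (fit X b') (fit X b), inner_neg_right, ← sub_eq_add_neg, ← inner_sub_left,
      ← real_inner_self_eq_norm_sq]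
    congr 1
    abel
  rw [h3]
  linarith

lemma norm_le_sum_abs (b : Fin p → ℝ) : ‖b‖ ≤ ∑ j, |b j| :=
  (pi_norm_le_iff_of_nonneg (Finset.sum_nonneg fun _ _ => abs_nonneg _)).2 fun j =>
    Finset.single_le_sum (f := fun j => |b j|) (fun _ _ => abs_nonneg _) (Finset.mem_univ j)

lemma continuous_objective :
    Continuous fun x : ℝ × (Fin p → ℝ) => objective X y x.1 x.2 := by
  unfold objective
  have := (continuous_fit (X := X)).comp (continuous_snd (X := ℝ) (Y := Fin p → ℝ))
  simp only [Function.comp_def] at this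
  fun_prop

lemma exists_isLasso (X : Matrix (Fin n) (Fin p) ℝ) (y : E n) (hl : 0 < lam) :
    ∃ b, IsLasso X y lam b := by
  have hc : Continuous fun b : Fin p → ℝ => objective X y lam b := by
    have h := (continuous_objective (X := X) (y := y)).comp
      (Continuous.prodMk_right (Y := Fin p → ℝ) lam)
    exact h
  refine hc.exists_forall_le' 0 ?_
  have hK := (isCompact_closedBall (0 : Fin p → ℝ) (‖y‖ ^ 2 / 2 / lam)).compl_mem_cocompact
  filter_upwards [hK] with b hb
  rw [Set.mem_compl_iff, mem_closedBall_zero_iff, not_le, div_lt_iff₀ hl] at hb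
  rw [objective_zero, objective]
  have := mul_le_mul_of_nonneg_left (norm_le_sum_abs b) hl.le
  nlinarith [sq_nonneg ‖y - fit X b‖]

/-- The variables whose correlation with the residual is exactly `± lam`. -/
noncomputable def equicorr (X : Matrix (Fin n) (Fin p) ℝ) (y : E n) (lam : ℝ) (b : Fin p → ℝ) :
    Finset (Fin p) :=
  Finset.univ.filter fun j => |⟪col X j, y - fit X b⟫| = lam

lemma mem_equicorr {j : Fin p} :
    j ∈ equicorr X y lam b ↔ |⟪col X j, y - fit X b⟫| = lam := by simp [equicorr]

lemma IsLasso.selected_subset_equicorr (h : IsLasso X y lam b) (hl : 0 ≤ lam) :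
    selected b ⊆ equicorr X y lam b := fun _ hj => mem_equicorr.2 (h.abs_inner_eq hl hj)

lemma IsLasso.equicorr_eq (h : IsLasso X y lam b) {b' : Fin p → ℝ} (h' : IsLasso X y lam b')
    (hl : 0 ≤ lam) : equicorr X y lam b = equicorr X y lam b' := by
  have h1 := h.norm_fit_sub_sq_le hl h' hl
  rw [sub_self, zero_mul] at h1
  have h2 : fit X b' = fit X b := by
    rw [← sub_eq_zero, ← norm_eq_zero]
    exact pow_eq_zero_iff two_ne_zero |>.1 (le_antisymm h1 (sq_nonneg _))
  rw [equicorr, equicorr, h2]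

/-- Along a family of LASSO estimators, the fit depends continuously on the penalty level. -/
lemma tendsto_fit_isLasso {b : ℝ → Fin p → ℝ} (hb : ∀ l, 0 < l → IsLasso X y l (b l))
    (hl : 0 < lam) : Tendsto (fun l => fit X (b l)) (𝓝 lam) (𝓝 (fit X (b lam))) := by
  rw [tendsto_iff_norm_sub_tendsto_zero]
  have hbound : ∀ l, lam / 2 < l → ∑ j, |b l j| ≤ ‖y‖ ^ 2 / lam := by
    intro l hl2
    have h1 := (hb l (by linarith)).sum_abs_le
    have h2 : 0 ≤ ∑ j, |b l j| := Finset.sum_nonneg fun j _ => abs_nonneg _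
    rw [le_div_iff₀ hl]
    nlinarith [mul_le_mul_of_nonneg_right hl2.le h2]
  have hsq : Tendsto (fun l => √(|l - lam| * (‖y‖ ^ 2 / lam))) (𝓝 lam) (𝓝 0) := by
    have hc : Continuous fun l : ℝ => √(|l - lam| * (‖y‖ ^ 2 / lam)) := by fun_prop
    simpa using hc.tendsto lam
  refine squeeze_zero' (Eventually.of_forall fun l => norm_nonneg _) ?_ hsq
  filter_upwards [lt_mem_nhds (show lam / 2 < lam by linarith)] with l hl2
  refine Real.le_sqrt_of_sq_le ?_
  have hl0 : 0 < l := by linarith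
  refine ((hb lam hl).norm_fit_sub_sq_le hl.le (hb l hl0) hl0.le).trans ?_
  refine (le_abs_self _).trans ?_
  rw [abs_mul, abs_sub_comm]
  refine mul_le_mul_of_nonneg_left ?_ (abs_nonneg _)
  have h1 := hbound l hl2
  have h2 := hbound lam (by linarith)
  have h3 : 0 ≤ ∑ j, |b l j| := Finset.sum_nonneg fun j _ => abs_nonneg _
  have h4 : 0 ≤ ∑ j, |b lam j| := Finset.sum_nonneg fun j _ => abs_nonneg _
  exact abs_le.2 ⟨by linarith, by linarith⟩

/-- A continuation argument along the penalty levels. If no model between the active set and the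
equicorrelation set, augmented by `B`, can have exactly `N` elements at any level above `lam₀`,
then all these models have less than `N` elements: this holds for large levels, where the LASSO
vanishes, and the sizes cannot jump over `N` because the equicorrelation set at nearby levels is
contained in the one at the limit. -/
lemma card_selected_union_lt {B : Finset (Fin p)} {N : ℕ} {lam₀ : ℝ} (hl₀ : 0 < lam₀)
    (hB : B.card ≤ N)
    (hstep : ∀ l, lam₀ ≤ l → ∀ b, IsLasso X y l b → ∀ A, selected b ⊆ A → B ⊆ A →
      A ⊆ equicorr X y l b ∪ B → A.card ≠ N) {b : Fin p → ℝ} (hb : IsLasso X y lam₀ b) :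
    (selected b ∪ B).card < N := by
  classical
  have claim : ∀ l, lam₀ ≤ l → ∀ b, IsLasso X y l b → (selected b ∪ B).card ≤ N →
      (equicorr X y l b ∪ B).card < N := by
    intro l hl b hb hc
    by_contra hcon
    push Not at hcon
    obtain ⟨A, hA1, hA2, hA3⟩ := Finset.exists_subsuperset_card_eq
      (Finset.union_subset_union_left (hb.selected_subset_equicorr (hl₀.le.trans hl)) :
        selected b ∪ B ⊆ equicorr X y l b ∪ B) hc hcon
    exact hstep l hl b hb A (Finset.subset_union_left.trans hA1)
      (Finset.subset_union_right.trans hA1) hA2 hA3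
  choose b₀ hb₀ using fun l : ℝ => fun hl : 0 < l => exists_isLasso X y hl
  let bf : ℝ → Fin p → ℝ := fun l => if hl : 0 < l then b₀ l hl else 0
  have hbf : ∀ l, 0 < l → IsLasso X y l (bf l) := fun l hl => by
    simp only [bf, hl, dif_pos]; exact hb₀ l hl
  -- at the level `l₁` the estimator vanishes
  set l₁ := max lam₀ (∑ j, ‖col X j‖ * ‖y‖ + 1) with hl₁
  have hl₁0 : 0 < l₁ := hl₀.trans_le (le_max_left _ _)
  let K : Set (ℝ × (Fin p → ℝ)) :=
    Set.Icc lam₀ l₁ ×ˢ Metric.closedBall 0 (‖y‖ ^ 2 / 2 / lam₀)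
  have hK : IsCompact K := isCompact_Icc.prod (isCompact_closedBall _ _)
  let S : Set (ℝ × (Fin p → ℝ)) :=
    {x | IsLasso X y x.1 x.2 ∧ (selected x.2 ∪ B).card ≤ N}
  have hS : IsClosed S := by
    have e : S = ⋃ T ∈ {T : Finset (Fin p) | (T ∪ B).card ≤ N},
        ((⋂ b', {x | objective X y x.1 x.2 ≤ objective X y x.1 b'}) ∩
          ⋂ j, ⋂ (_ : j ∉ T), {x : ℝ × (Fin p → ℝ) | x.2 j = 0}) := by
      ext x
      simp only [S, Set.mem_iUnion, Set.mem_inter_iff, Set.mem_iInter, Set.mem_ofPred_eq,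
        exists_prop]
      constructor
      · rintro ⟨h1, h2⟩
        exact ⟨selected x.2, h2, h1, fun j hj => by
          by_contra h; exact hj (mem_selected.2 h)⟩
      · rintro ⟨T, hT, h1, h2⟩
        refine ⟨h1, (Finset.card_le_card (Finset.union_subset_union_left fun j hj => ?_)).trans hT⟩
        by_contra h
        exact mem_selected.1 hj (h2 j h)
    rw [e]
    refine (Set.toFinite _).isClosed_biUnion fun T _ => IsClosed.inter ?_ ?_
    · exact isClosed_iInter fun b' => isClosed_le continuous_objective
        (((continuous_objective (X := X) (y := y)).comp (Continuous.prodMk_left b')).comp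
          continuous_fst)
    · exact isClosed_iInter fun j => isClosed_iInter fun _ =>
        isClosed_eq (by fun_prop) continuous_const
  have hΛc : IsCompact (Prod.fst '' (K ∩ S)) := (hK.inter_right hS).image continuous_fst
  have hmem : ∀ l, lam₀ ≤ l → l ≤ l₁ → ∀ b, IsLasso X y l b → (selected b ∪ B).card ≤ N →
      l ∈ Prod.fst '' (K ∩ S) := by
    intro l h1 h2 b h3 h4
    refine ⟨(l, b), ⟨⟨⟨h1, h2⟩, ?_⟩, h3, h4⟩, rfl⟩
    rw [mem_closedBall_zero_iff, le_div_iff₀ hl₀]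
    have h5 : 0 ≤ ∑ j, |b j| := Finset.sum_nonneg fun j _ => abs_nonneg _
    nlinarith [h3.sum_abs_le, norm_le_sum_abs b, norm_nonneg b]
  have hne : (Prod.fst '' (K ∩ S)).Nonempty := by
    refine ⟨l₁, hmem l₁ (le_max_left _ _) le_rfl _ (hbf l₁ hl₁0) ?_⟩
    have h0 : selected (bf l₁) = ∅ := by
      rw [Finset.eq_empty_iff_forall_notMem]
      intro j hj
      have h1 := (hbf l₁ hl₁0).abs_inner_eq hl₁0.le hj
      have h2 : |⟪col X j, y - fit X (bf l₁)⟫| ≤ ‖col X j‖ * ‖y‖ :=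
        (abs_real_inner_le_norm _ _).trans (mul_le_mul_of_nonneg_left
          ((hbf l₁ hl₁0).norm_residual_le hl₁0.le) (norm_nonneg _))
      have h3 : ‖col X j‖ * ‖y‖ ≤ ∑ j, ‖col X j‖ * ‖y‖ :=
        Finset.single_le_sum (f := fun j => ‖col X j‖ * ‖y‖) (fun j _ => by positivity)
          (Finset.mem_univ j)
      have h4 : ∑ j, ‖col X j‖ * ‖y‖ + 1 ≤ l₁ := le_max_right _ _
      linarith
    rw [h0, Finset.empty_union]
    exact hB
  obtain ⟨l, hl, hmin⟩ := hΛc.exists_isLeast hne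
  obtain ⟨⟨l', b'⟩, ⟨⟨⟨hl1, hl2⟩, -⟩, hb'1, hb'2⟩, rfl⟩ := hl
  simp only at hl1 hl2 hb'1 hb'2 hmin
  have hl0 : 0 < l' := hl₀.trans_le hl1
  have hlt := claim l' hl1 b' hb'1 hb'2
  rcases hl1.eq_or_lt with heq | hlt'
  · subst heq
    rw [hb'1.equicorr_eq hb hl₀.le] at hlt
    exact (Finset.card_le_card (Finset.union_subset_union_left
      (hb.selected_subset_equicorr hl₀.le))).trans_lt hlt
  · -- the levels just below `l'` also belong to the compact set, against minimality
    exfalso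
    rw [hb'1.equicorr_eq (hbf l' hl0) hl0.le] at hlt
    have hev : ∀ᶠ l in 𝓝 l', ∀ j, j ∉ equicorr X y l' (bf l') → j ∉ equicorr X y l (bf l) := by
      rw [eventually_all]
      intro j
      by_cases hj : j ∈ equicorr X y l' (bf l')
      · exact Eventually.of_forall fun l h => absurd hj h
      have hjlt : |⟪col X j, y - fit X (bf l')⟫| < l' :=
        lt_of_le_of_ne ((hbf l' hl0).abs_inner_le hl0.le j) fun h => hj (mem_equicorr.2 h)
      have ht : Tendsto (fun l => |⟪col X j, y - fit X (bf l)⟫|) (𝓝 l')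
          (𝓝 |⟪col X j, y - fit X (bf l')⟫|) :=
        (tendsto_const_nhds.inner (tendsto_const_nhds.sub (tendsto_fit_isLasso hbf hl0))).abs
      filter_upwards [ht.eventually_lt tendsto_id hjlt] with l hl _ h
      exact hl.ne (mem_equicorr.1 h)
    obtain ⟨l, hl3, hl4⟩ := ((hev.filter_mono nhdsWithin_le_nhds).and
      (Ico_mem_nhdsLT hlt')).exists
    have hl5 : 0 < l := hl₀.trans_le hl4.1
    refine absurd (hmin (hmem l hl4.1 (hl4.2.le.trans hl2) (bf l) (hbf l hl5) ?_)) (not_le.2 hl4.2)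
    refine (Finset.card_le_card (Finset.union_subset_union_left fun j hj => ?_)).trans hlt.le
    by_contra h
    exact hl3 j h ((hbf l hl5).selected_subset_equicorr hl5.le hj)

end Lasso

/-! ### The good noise set and its probability -/

namespace Lasso

open scoped RealInnerProductSpace

variable {n p : ℕ} {X : Matrix (Fin n) (Fin p) ℝ}

open Classical in
/-- The vector dual to `h` on the model `A` in the sense of `IsDual`, and `0` if there is none. -/
noncomputable def dualVec (X : Matrix (Fin n) (Fin p) ℝ) (A : Finset (Fin p)) (h : Fin p → ℝ) :
    E n :=
  if H : ∃ u, IsDual X A h u then H.choose else 0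

lemma IsDual.dualVec_eq {A : Finset (Fin p)} {h : Fin p → ℝ} {u : E n} (hu : IsDual X A h u) :
    dualVec X A h = u := by
  have H : ∃ u, IsDual X A h u := ⟨u, hu⟩
  rw [dualVec, dif_pos H]
  exact H.choose_spec.unique hu

lemma dualVec_mem (A : Finset (Fin p)) (h : Fin p → ℝ) : dualVec X A h ∈ modelSpan X A := by
  rw [dualVec]
  split_ifs with H
  · exact H.choose_spec.1
  · exact Submodule.zero_mem _

lemma dualVec_neg (A : Finset (Fin p)) (h : Fin p → ℝ) :
    dualVec X A (-h) = -dualVec X A h := by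
  by_cases H : ∃ u, IsDual X A h u
  · obtain ⟨u, hu⟩ := H
    rw [hu.dualVec_eq]
    refine IsDual.dualVec_eq ⟨Submodule.neg_mem _ hu.1, fun j hj => ?_⟩
    rw [inner_neg_right, hu.2 j hj, Pi.neg_apply]
  · have H' : ¬ ∃ u, IsDual X A (-h) u := by
      rintro ⟨u, hu⟩
      refine H ⟨-u, Submodule.neg_mem _ hu.1, fun j hj => ?_⟩
      rw [inner_neg_right, hu.2 j hj, Pi.neg_apply, neg_neg]
    rw [dualVec, dif_neg H', dualVec, dif_neg H, neg_zero]

/-- The sign vectors with entries `-1, 0, 1` on `A` and `0` outside `A`. -/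
noncomputable def signVectors (A : Finset (Fin p)) : Finset (Fin p → ℝ) :=
  Fintype.piFinset fun j => if j ∈ A then {-1, 0, 1} else {0}

lemma mem_signVectors {A : Finset (Fin p)} {s : Fin p → ℝ} :
    s ∈ signVectors A ↔ (∀ j ∈ A, s j = -1 ∨ s j = 0 ∨ s j = 1) ∧ ∀ j ∉ A, s j = 0 := by
  simp only [signVectors, Fintype.mem_piFinset]
  constructor
  · exact fun h => ⟨fun j hj => by simpa [hj] using h j, fun j hj => by simpa [hj] using h j⟩
  · rintro ⟨h1, h2⟩ j
    by_cases hj : j ∈ A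
    · simpa [hj] using h1 j hj
    · simpa [hj] using h2 j hj

lemma card_signVectors (A : Finset (Fin p)) : (signVectors A).card = 3 ^ A.card := by
  rw [signVectors, Fintype.card_piFinset]
  have h3 : ({-1, 0, 1} : Finset ℝ).card = 3 := by
    rw [Finset.card_insert_of_notMem (by norm_num), Finset.card_insert_of_notMem (by norm_num),
      Finset.card_singleton]
  have : ∀ j, (if j ∈ A then ({-1, 0, 1} : Finset ℝ) else {0}).card = if j ∈ A then 3 else 1 := by
    intro j
    split_ifs
    · exact h3
    · rfl
  simp only [this]
  rw [Finset.prod_ite_mem, Finset.univ_inter, Finset.prod_const]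

/-- The noise vectors whose projection onto the span of `dualVec X A s` and `missed X β A`, two
orthogonal vectors, has squared norm exceeding `t`. A zero vector stays zero under the
normalisation and contributes nothing. -/
def excess (X : Matrix (Fin n) (Fin p) ℝ) (β : Fin p → ℝ) (A : Finset (Fin p)) (s : Fin p → ℝ)
    (t : ℝ) : Set (E n) :=
  {z | t < ⟪‖dualVec X A s‖⁻¹ • dualVec X A s, z⟫ ^ 2
    + ⟪‖missed X β A‖⁻¹ • missed X β A, z⟫ ^ 2}

/-- The bound on the squared norm of projected noise allowed for models of size `m`. -/
noncomputable def noiseLevel (p : ℕ) (c₀ a : ℝ) (m : ℕ) : ℝ :=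
  2 * ((1 + c₀) * max (m : ℝ) 1 * Real.log (max (p : ℝ) a))

/-- The set of good standardised noise vectors. The planes with `s = 0` are left out unless `A` is
empty: they contain only the direction of `missed X β A`, which lies in all other planes of the
model `A`. -/
def noiseSet (X : Matrix (Fin n) (Fin p) ℝ) (β : Fin p → ℝ) (c₀ a : ℝ) : Set (E n) :=
  {z | ∀ A : Finset (Fin p), ∀ s ∈ signVectors A, (A = ∅ ∨ s ≠ 0) →
    z ∉ excess X β A s (noiseLevel p c₀ a A.card)}

lemma measurableSet_excess (β : Fin p → ℝ) (A : Finset (Fin p)) (s : Fin p → ℝ) (t : ℝ) :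
    MeasurableSet (excess X β A s t) :=
  measurableSet_lt (by fun_prop) (by fun_prop)

lemma measurableSet_noiseSet (X : Matrix (Fin n) (Fin p) ℝ) (β : Fin p → ℝ) (c₀ a : ℝ) :
    MeasurableSet (noiseSet X β c₀ a) := by
  have e : noiseSet X β c₀ a = ⋂ A : Finset (Fin p), ⋂ s ∈ (signVectors A : Set (Fin p → ℝ)),
      ⋂ (_ : A = ∅ ∨ s ≠ 0), (excess X β A s (noiseLevel p c₀ a A.card))ᶜ := by
    ext z
    simp [noiseSet]
  rw [e]
  exact MeasurableSet.iInter fun A => MeasurableSet.biInter (signVectors A).countable_toSet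
    fun s _ => MeasurableSet.iInter fun _ => (measurableSet_excess β A s _).compl

lemma excess_neg (β : Fin p → ℝ) (A : Finset (Fin p)) (s : Fin p → ℝ) (t : ℝ) :
    excess X β A (-s) t = excess X β A s t := by
  simp only [excess, dualVec_neg, norm_neg, smul_neg, inner_neg_left, neg_sq]

lemma norm_inv_norm_smul_le (u : E n) : ‖‖u‖⁻¹ • u‖ ≤ 1 := by
  rw [norm_smul, norm_inv, norm_norm]
  exact inv_mul_le_one

lemma stdGaussian_excess_le (β : Fin p → ℝ) (A : Finset (Fin p)) (s : Fin p → ℝ) {t : ℝ}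
    (ht : 0 ≤ t) : (stdGaussian (E n)).real (excess X β A s t) ≤ Real.exp (-(t / 2)) := by
  have horth : ⟪‖dualVec X A s‖⁻¹ • dualVec X A s, ‖missed X β A‖⁻¹ • missed X β A⟫ = 0 := by
    rw [real_inner_smul_left, real_inner_smul_right, real_inner_comm,
      inner_missed_eq_zero β (dualVec_mem A s), mul_zero, mul_zero]
  exact ENNReal.toReal_le_of_le_ofReal (Real.exp_nonneg _)
    (stdGaussian_inner_sq_add_inner_sq_gt_le horth (norm_inv_norm_smul_le _)
      (norm_inv_norm_smul_le _) ht)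

lemma inner_sq_add_inner_sq_le_of_mem_noiseSet {β : Fin p → ℝ} {c₀ a : ℝ} {z : E n}
    (hz : z ∈ noiseSet X β c₀ a) {A : Finset (Fin p)} {s : Fin p → ℝ} (hs : s ∈ signVectors A)
    {u : E n} (hu : IsDual X A s u) :
    ⟪‖u‖⁻¹ • u, z⟫ ^ 2 + ⟪‖missed X β A‖⁻¹ • missed X β A, z⟫ ^ 2
      ≤ noiseLevel p c₀ a A.card := by
  by_cases h : A = ∅ ∨ s ≠ 0
  · have := hz A s hs h
    simp only [excess, Set.mem_ofPred_eq, not_lt, hu.dualVec_eq] at this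
    exact this
  · push Not at h
    obtain ⟨hA, rfl⟩ := h
    obtain ⟨j, hj⟩ := hA
    have hu0 : u = 0 := hu.unique ⟨Submodule.zero_mem _, fun j _ => inner_zero_right _⟩
    have hmem : (Pi.single j 1 : Fin p → ℝ) ∈ signVectors A := by
      refine mem_signVectors.2 ⟨fun k _ => ?_, fun k hk => ?_⟩
      · by_cases hkj : k = j
        · subst hkj; simp
        · simp [hkj]
      · have hkj : k ≠ j := fun h => hk (h ▸ hj)
        simp [hkj]
    have := hz A _ hmem (Or.inr fun h => by simpa using congrFun h j)
    simp only [excess, Set.mem_ofPred_eq, not_lt] at this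
    rw [hu0, smul_zero, inner_zero_left, zero_pow two_ne_zero, zero_add]
    exact (le_add_of_nonneg_left (sq_nonneg _)).trans this

/-- The noise bound on the good set, uniformly over the multiples `c • u`: all the vectors
`c • u - missed X β A` lie in one plane. -/
lemma inner_le_of_mem_noiseSet {β : Fin p → ℝ} {c₀ a : ℝ} {z : E n}
    (hz : z ∈ noiseSet X β c₀ a) {A : Finset (Fin p)} {s : Fin p → ℝ} (hs : s ∈ signVectors A)
    {u : E n} (hu : IsDual X A s u) (c : ℝ) :
    ⟪c • u - missed X β A, z⟫ ≤ √(‖c • u‖ ^ 2 + ‖missed X β A‖ ^ 2)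
      * √(noiseLevel p c₀ a A.card) := by
  have hunit : ∀ v : E n, ‖v‖ • ‖v‖⁻¹ • v = v := by
    intro v
    rcases eq_or_ne v 0 with rfl | hv
    · simp
    · exact smul_inv_smul₀ (norm_ne_zero_iff.2 hv) v
  have key := inner_sq_add_inner_sq_le_of_mem_noiseSet hz hs hu
  set ω := missed X β A
  set f := ⟪‖u‖⁻¹ • u, z⟫ with hf
  set g := ⟪‖ω‖⁻¹ • ω, z⟫ with hg
  have e1 : ⟪u, z⟫ = ‖u‖ * f := by rw [hf, ← real_inner_smul_left, hunit]
  have e2 : ⟪ω, z⟫ = ‖ω‖ * g := by rw [hg, ← real_inner_smul_left, hunit]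
  rw [inner_sub_left, real_inner_smul_left, e1, e2, norm_smul, Real.norm_eq_abs, mul_pow, sq_abs]
  calc c * (‖u‖ * f) - ‖ω‖ * g
      ≤ √((c ^ 2 * ‖u‖ ^ 2 + ‖ω‖ ^ 2) * (f ^ 2 + g ^ 2)) := by
        refine Real.le_sqrt_of_sq_le ?_
        nlinarith [sq_nonneg (c * ‖u‖ * g + ‖ω‖ * f)]
    _ = √(c ^ 2 * ‖u‖ ^ 2 + ‖ω‖ ^ 2) * √(f ^ 2 + g ^ 2) := Real.sqrt_mul (by positivity) _
    _ ≤ _ := mul_le_mul_of_nonneg_left (Real.sqrt_le_sqrt key) (Real.sqrt_nonneg _)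

/-- The union bound gains a factor two when the events coincide in pairs. -/
lemma two_mul_measureReal_biUnion_le {Ω ι : Type*} [MeasurableSpace Ω] {μ : Measure Ω}
    [IsFiniteMeasure μ] {S : Finset ι} {F : ι → Set Ω} {σ : ι → ι}
    (hF : ∀ i ∈ S, MeasurableSet (F i)) (hσ : ∀ i ∈ S, σ i ∈ S) (hne : ∀ i ∈ S, i ≠ σ i)
    (hFσ : ∀ i ∈ S, F (σ i) = F i) :
    2 * μ.real (⋃ i ∈ S, F i) ≤ ∑ i ∈ S, μ.real (F i) := by
  classical
  have hU : MeasurableSet (⋃ i ∈ S, F i) := Finset.measurableSet_biUnion _ hF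
  have key : 2 * μ (⋃ i ∈ S, F i) ≤ ∑ i ∈ S, μ (F i) := by
    calc 2 * μ (⋃ i ∈ S, F i) = ∫⁻ x, (⋃ i ∈ S, F i).indicator (fun _ => 2) x ∂μ := by
          rw [lintegral_indicator_const hU]
      _ ≤ ∫⁻ x, ∑ i ∈ S, (F i).indicator (fun _ => 1) x ∂μ := by
          refine lintegral_mono fun x => ?_
          by_cases hx : x ∈ ⋃ i ∈ S, F i
          · rw [Set.indicator_of_mem hx]
            simp only [Set.mem_iUnion, exists_prop] at hx
            obtain ⟨i, hi, hxi⟩ := hx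
            calc (2 : ℝ≥0∞) = ∑ k ∈ {i, σ i}, (F k).indicator (fun _ => (1 : ℝ≥0∞)) x := by
                  rw [Finset.sum_pair (hne i hi), Set.indicator_of_mem hxi,
                    Set.indicator_of_mem (by rw [hFσ i hi]; exact hxi), one_add_one_eq_two]
              _ ≤ _ := Finset.sum_le_sum_of_subset (by
                  intro k hk
                  rcases Finset.mem_insert.1 hk with rfl | hk
                  · exact hi
                  · rw [Finset.mem_singleton.1 hk]; exact hσ i hi)
          · rw [Set.indicator_of_notMem hx]
            exact zero_le
      _ = ∑ i ∈ S, μ (F i) := by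
          rw [lintegral_finsetSum' _ fun i hi =>
            (measurable_const.indicator (hF i hi)).aemeasurable]
          exact Finset.sum_congr rfl fun i hi => by
            rw [lintegral_indicator_const (hF i hi), one_mul]
  have h2 := ENNReal.toReal_mono (ENNReal.sum_ne_top.2 fun i _ => measure_ne_top μ _) key
  rw [ENNReal.toReal_mul, ENNReal.toReal_sum fun i _ => measure_ne_top μ _] at h2
  simpa [Measure.real] using h2

lemma exp_neg_noiseLevel {c₀ a : ℝ} (hp : 1 ≤ p) (m : ℕ) :
    Real.exp (-(noiseLevel p c₀ a m / 2)) = ((max (p : ℝ) a ^ (1 + c₀))⁻¹) ^ max m 1 := by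
  have hM : 0 < max (p : ℝ) a := lt_max_of_lt_left (by exact_mod_cast hp)
  rw [noiseLevel, mul_div_cancel_left₀ _ two_ne_zero, ← Real.rpow_neg hM.le, ← Real.rpow_natCast,
    ← Real.rpow_mul hM.le, Real.rpow_def_of_pos hM]
  congr 1
  push_cast
  ring

/-- The union bound over all planes. For a model of size `m` there are `(3 ^ m - 1) / 2` planes,
as `s` and `-s` span the same one. -/
lemma stdGaussian_compl_noiseSet_le {c₀ a : ℝ} (hp : 1 ≤ p) (hc₀ : 0 ≤ c₀)
    (X : Matrix (Fin n) (Fin p) ℝ) (β : Fin p → ℝ) {u : ℝ}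
    (hu : u = (max (p : ℝ) a ^ (1 + c₀))⁻¹) :
    (stdGaussian (E n)).real (noiseSet X β c₀ a)ᶜ
      ≤ u + ((3 * u + 1) ^ p - (u + 1) ^ p) / 2 := by
  classical
  set μ := stdGaussian (E n)
  have hlev : ∀ m, 0 ≤ noiseLevel p c₀ a m := fun m => by
    have : 0 ≤ Real.log (max (p : ℝ) a) :=
      Real.log_nonneg (le_max_of_le_left (by exact_mod_cast hp))
    unfold noiseLevel
    positivity
  have hex : ∀ (A : Finset (Fin p)) s,
      μ.real (excess X β A s (noiseLevel p c₀ a A.card)) ≤ u ^ max A.card 1 := fun A s => by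
    rw [hu, ← exp_neg_noiseLevel hp]
    exact stdGaussian_excess_le β A s (hlev _)
  let U : Finset (Fin p) → Set (E n) := fun A =>
    ⋃ s ∈ (signVectors A).erase 0, excess X β A s (noiseLevel p c₀ a A.card)
  have hsub : (noiseSet X β c₀ a)ᶜ ⊆ excess X β ∅ 0 (noiseLevel p c₀ a 0)
      ∪ ⋃ A ∈ (Finset.univ : Finset (Finset (Fin p))), U A := by
    intro z hz
    simp only [noiseSet, Set.mem_compl_iff, Set.mem_ofPred_eq, not_forall, not_not] at hz
    obtain ⟨A, s, hs, hor, hz⟩ := hz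
    by_cases hs0 : s = 0
    · have hA : A = ∅ := hor.resolve_right fun h => h hs0
      subst hs0 hA
      exact Or.inl hz
    · refine Or.inr ?_
      simp only [U, Set.mem_iUnion]
      exact ⟨A, Finset.mem_univ _, s, Finset.mem_erase.2 ⟨hs0, hs⟩, hz⟩
  have h0mem : ∀ A : Finset (Fin p), (0 : Fin p → ℝ) ∈ signVectors A := fun A =>
    mem_signVectors.2 ⟨fun _ _ => Or.inr (Or.inl rfl), fun _ _ => rfl⟩
  have hU : ∀ A, μ.real (U A) ≤ ((3 * u) ^ A.card - u ^ A.card) / 2 := by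
    intro A
    rcases A.eq_empty_or_nonempty with rfl | hA
    · have : (signVectors (∅ : Finset (Fin p))).erase 0 = ∅ := by
        rw [← Finset.card_eq_zero, Finset.card_erase_of_mem (h0mem _), card_signVectors]
        rfl
      have hU0 : U ∅ = ∅ := by
        simp only [U, this, Finset.notMem_empty, Set.iUnion_of_empty, Set.iUnion_empty]
      simp [hU0]
    · have h1 := two_mul_measureReal_biUnion_le (μ := μ) (S := (signVectors A).erase 0)
        (F := fun s => excess X β A s (noiseLevel p c₀ a A.card)) (σ := fun s => -s)
        (fun s _ => measurableSet_excess β A s _)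
        (fun s hs => by
          obtain ⟨hs0, hs⟩ := Finset.mem_erase.1 hs
          rw [mem_signVectors] at hs
          refine Finset.mem_erase.2 ⟨neg_ne_zero.2 hs0, mem_signVectors.2
            ⟨fun j hj => ?_, fun j hj => ?_⟩⟩
          · rcases hs.1 j hj with h | h | h <;> simp [h]
          · simp [hs.2 j hj])
        (fun s hs h => (Finset.mem_erase.1 hs).1 (self_eq_neg.1 h))
        (fun s _ => excess_neg β A s _)
      have h2 : ∑ s ∈ (signVectors A).erase 0,
          μ.real (excess X β A s (noiseLevel p c₀ a A.card))
            ≤ ((signVectors A).erase 0).card • u ^ A.card := by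
        refine Finset.sum_le_card_nsmul _ _ _ fun s _ => (hex A s).trans (le_of_eq ?_)
        rw [max_eq_left (Finset.card_pos.2 hA)]
      rw [nsmul_eq_mul, Finset.card_erase_of_mem (h0mem A), card_signVectors,
        Nat.cast_sub (Nat.one_le_pow _ _ (by norm_num))] at h2
      push_cast at h2
      rw [mul_pow]
      linarith
  have hsum : ∀ v : ℝ, ∑ A : Finset (Fin p), v ^ A.card = (v + 1) ^ p := fun v => by
    simpa using Fintype.sum_pow_mul_eq_add_pow (Fin p) v 1
  calc μ.real (noiseSet X β c₀ a)ᶜ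
      ≤ μ.real (excess X β ∅ 0 (noiseLevel p c₀ a 0)
        ∪ ⋃ A ∈ (Finset.univ : Finset (Finset (Fin p))), U A) := measureReal_mono hsub
    _ ≤ μ.real (excess X β ∅ 0 (noiseLevel p c₀ a 0)) + ∑ A, μ.real (U A) :=
      (measureReal_union_le _ _).trans
        (add_le_add le_rfl (measureReal_biUnion_finset_le _ _))
    _ ≤ u + ∑ A : Finset (Fin p), ((3 * u) ^ A.card - u ^ A.card) / 2 := by
      refine add_le_add ?_ (Finset.sum_le_sum fun A _ => hU A)
      simpa using hex ∅ 0
    _ = _ := by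
      rw [← Finset.sum_div, Finset.sum_sub_distrib, hsum, hsum]

lemma add_one_pow_sub_le {u : ℝ} (hu : 0 ≤ u) (p : ℕ) :
    (3 * u + 1) ^ p - (u + 1) ^ p ≤ Real.exp (p * u) * (Real.exp (p * u) ^ 2 - 1) := by
  have h1 : (u + 1) ^ p ≤ Real.exp (p * u) := by
    rw [Real.exp_nat_mul]
    exact pow_le_pow_left₀ (by positivity) (Real.add_one_le_exp u) p
  have h2 : (3 * u + 1) ^ p ≤ (u + 1) ^ p * Real.exp (p * u) ^ 2 := by
    have h3 : (2 * u + 1) ^ p ≤ Real.exp (p * u) ^ 2 := by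
      rw [← Real.exp_nat_mul, Nat.cast_ofNat, mul_left_comm, Real.exp_nat_mul]
      exact pow_le_pow_left₀ (by positivity) (Real.add_one_le_exp (2 * u)) p
    calc (3 * u + 1) ^ p ≤ ((u + 1) * (2 * u + 1)) ^ p :=
          pow_le_pow_left₀ (by positivity) (by nlinarith) p
      _ = (u + 1) ^ p * (2 * u + 1) ^ p := mul_pow _ _ _
      _ ≤ _ := mul_le_mul_of_nonneg_left h3 (by positivity)
  have h4 : 1 ≤ Real.exp (p * u) ^ 2 := one_le_pow₀ (Real.one_le_exp (by positivity))
  nlinarith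

/-- The good set has the required probability: the union bound gives
`1 - u - (y ^ 3 - y) / 2` with `u = (p ∨ a) ^ (-(1 + c₀))` and `y = exp (p u)`, which is at least
`2 - y ^ 2 - 2 u` as long as `y ≤ 2`, and for larger `y` the claimed bound is negative. -/
lemma probBound_le_stdGaussian_noiseSet {c₀ a : ℝ} (hp : 1 ≤ p) (hc₀ : 0 ≤ c₀)
    (X : Matrix (Fin n) (Fin p) ℝ) (β : Fin p → ℝ) :
    probBound p a c₀ ≤ (stdGaussian (E n)).real (noiseSet X β c₀ a) := by
  have hM : 0 < max (p : ℝ) a := lt_max_of_lt_left (by exact_mod_cast hp)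
  set u := (max (p : ℝ) a ^ (1 + c₀))⁻¹ with hu
  have hu0 : 0 < u := inv_pos.2 (Real.rpow_pos_of_pos hM _)
  set y := Real.exp (p * u) with hy
  have hpb : probBound p a c₀ = 2 - y ^ 2 - 2 * u := by
    rw [probBound, hy, ← Real.exp_nat_mul, Nat.cast_ofNat, hu, div_eq_mul_inv, div_eq_mul_inv,
      mul_assoc]
  have hy1 : 1 ≤ y := Real.one_le_exp (by positivity)
  rw [hpb]
  by_cases hy2 : y ≤ 2
  · have h1 := stdGaussian_compl_noiseSet_le hp hc₀ X β hu
    rw [probReal_compl_eq_one_sub (measurableSet_noiseSet X β c₀ a)] at h1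
    have h2 := add_one_pow_sub_le hu0.le p
    rw [← hy] at h2
    nlinarith [mul_nonneg (mul_nonneg (sub_nonneg.2 hy2) (sub_nonneg.2 hy1))
      (by linarith : 0 ≤ y + 1)]
  · push Not at hy2
    have := measureReal_nonneg (μ := stdGaussian (E n)) (s := noiseSet X β c₀ a)
    nlinarith

lemma tendsto_probBound {ps : ℕ → ℕ} {as cs : ℕ → ℝ} (hps : ∀ k, 1 ≤ ps k)
    (h : Tendsto (fun k => (ps k : ℝ) / max (ps k : ℝ) (as k) ^ (1 + cs k)) atTop (𝓝 0)) :
    Tendsto (fun k => probBound (ps k) (as k) (cs k)) atTop (𝓝 1) := by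
  have hpos : ∀ k, 0 < max (ps k : ℝ) (as k) ^ (1 + cs k) := fun k =>
    Real.rpow_pos_of_pos (lt_max_of_lt_left (by exact_mod_cast hps k)) _
  have h1 : Tendsto (fun k => 1 / max (ps k : ℝ) (as k) ^ (1 + cs k)) atTop (𝓝 0) := by
    refine squeeze_zero (fun k => (one_div_pos.2 (hpos k)).le) (fun k => ?_) h
    exact div_le_div_of_nonneg_right (by exact_mod_cast hps k) (hpos k).le
  have h2 := ((Real.continuous_exp.tendsto _).comp (h.const_mul 2)).const_sub 2 |>.sub
    (h1.const_mul 2)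
  simp only [mul_zero, Real.exp_zero] at h2
  norm_num at h2
  refine h2.congr fun k => ?_
  simp only [probBound]
  ring_nf

end Lasso

/-! ### Admissible penalty levels and the bounds on the good set -/

namespace Lasso

open scoped RealInnerProductSpace

variable {n p : ℕ} {X : Matrix (Fin n) (Fin p) ℝ}

lemma M₁_antitoneOn {q : ℕ} {cL cU η₁ η₂ l l' : ℝ} (hcU : 0 ≤ cU) (hη₁ : 0 ≤ η₁) (hq : 1 ≤ q)
    (hl : 0 < l) (hll' : l ≤ l') : M₁ n q cL cU η₁ η₂ l' ≤ M₁ n q cL cU η₁ η₂ l := by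
  have hq' : (0 : ℝ) < q := by exact_mod_cast hq
  have h1 : r₁ n q cU η₁ l' ≤ r₁ n q cU η₁ l := by
    refine Real.sqrt_le_sqrt (div_le_div_of_nonneg_left (by positivity) (by positivity) ?_)
    exact mul_le_mul_of_nonneg_left hll' hq'.le
  have h2 : r₂ n q cU η₂ l' ≤ r₂ n q cU η₂ l := by
    refine Real.sqrt_le_sqrt (div_le_div_of_nonneg_left (by positivity) (by positivity) ?_)
    exact mul_le_mul_of_nonneg_left (pow_le_pow_left₀ hl.le hll' 2) hq'.le
  have h3 : r₁ n q cU η₁ l' ^ 2 ≤ r₁ n q cU η₁ l ^ 2 :=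
    pow_le_pow_left₀ (Real.sqrt_nonneg _) h1 2
  have h4 := mul_le_mul_of_nonneg_left h2 (by positivity : 0 ≤ 4 * √(cU / cL))
  unfold M₁
  linarith

lemma two_le_M₁ {q : ℕ} {cL cU η₁ η₂ l : ℝ} (hcL : 0 ≤ cL) (hcU : 0 ≤ cU) :
    2 ≤ M₁ n q cL cU η₁ η₂ l := by
  have h2 : 0 ≤ r₂ n q cU η₂ l := Real.sqrt_nonneg _
  have h3 : 0 ≤ 4 * r₁ n q cU η₁ l ^ 2 + 4 * √(cU / cL) * r₂ n q cU η₂ l + 4 * (cU / cL) := by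
    positivity
  unfold M₁
  linarith

/-- An admissible penalty level is positive: if there is one at all, the rank `q^*` and hence `p`
are at least `3`, so that `log (p ∨ a) > 0`. -/
lemma Admissible.pos {q qs : ℕ} {cL cU η₁ η₂ σ c₀ a lam : ℝ}
    (h : Admissible n p q qs cL cU η₁ η₂ σ c₀ a lam) (hR : SparseRiesz X qs cL cU) (hn : 1 ≤ n)
    (hq : 1 ≤ q) (hσ : 0 < σ) (hc₀ : 0 ≤ c₀) : 0 < lam := by
  have hcL : 0 < cL := hR.2.1
  have hcU : 0 < cU := hcL.trans hR.2.2.1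
  have hn' : (0 : ℝ) < n := by exact_mod_cast hn
  have hq' : (1 : ℝ) ≤ q := by exact_mod_cast hq
  obtain ⟨_, ⟨l, ⟨hl0, hl⟩, rfl⟩, -⟩ := sInf_lt_iff.1 (h.1.trans_lt (EReal.coe_lt_top lam))
  have hM := two_le_M₁ (n := n) (q := q) (η₁ := η₁) (η₂ := η₂) (l := l) hcL.le hcU.le
  have hp : (1 : ℝ) < p := by
    have h1 : (qs : ℝ) ≤ p := by exact_mod_cast hR.1
    nlinarith
  have hlog : 0 < Real.log (max (p : ℝ) a) := Real.log_pos (lt_max_of_lt_left hp)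
  refine lt_of_lt_of_le ?_ h.2
  unfold lamNP
  have : 0 < 2 * (1 + c₀) * cU * n * Real.log (max (p : ℝ) a) := by positivity
  have := Real.sqrt_pos.2 this
  positivity

/-- The infimum defining `lam_*` is attained, as `M₁^*` is continuous and decreasing. -/
lemma Admissible.M₁_mul_add_one_le {q qs : ℕ} {cL cU η₁ η₂ σ c₀ a lam : ℝ}
    (h : Admissible n p q qs cL cU η₁ η₂ σ c₀ a lam) (hl : 0 < lam) (hcU : 0 ≤ cU) (hη₁ : 0 ≤ η₁)
    (hq : 1 ≤ q) : M₁ n q cL cU η₁ η₂ lam * q + 1 ≤ qs := by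
  have hq' : (q : ℝ) ≠ 0 := by positivity
  have hc : ContinuousAt (fun l => M₁ n q cL cU η₁ η₂ l * q + 1) lam := by
    have e1 : ContinuousAt (fun l => cU * η₁ * n / (q * l)) lam :=
      ContinuousAt.div (by fun_prop) (by fun_prop) (mul_ne_zero hq' hl.ne')
    have e2 : ContinuousAt (fun l => cU * η₂ ^ 2 * n / (q * l ^ 2)) lam :=
      ContinuousAt.div (by fun_prop) (by fun_prop) (mul_ne_zero hq' (pow_ne_zero 2 hl.ne'))
    unfold M₁ r₁ r₂
    fun_prop
  refine le_of_tendsto (hc.tendsto.mono_left (nhdsWithin_le_nhds (s := Set.Ioi lam))) ?_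
  filter_upwards [self_mem_nhdsWithin] with l' hl'
  obtain ⟨_, ⟨l, ⟨hl0, hl1⟩, rfl⟩, hll'⟩ :=
    sInf_lt_iff.1 (h.1.trans_lt (EReal.coe_lt_coe_iff.2 hl'))
  have h1 := M₁_antitoneOn (n := n) (cL := cL) (η₂ := η₂) hcU hη₁ hq hl0
    (EReal.coe_lt_coe_iff.1 hll').le
  have h2 := mul_le_mul_of_nonneg_right h1 (Nat.cast_nonneg q)
  linarith

lemma Admissible.mono {q qs : ℕ} {cL cU η₁ η₂ σ c₀ a lam l : ℝ}
    (h : Admissible n p q qs cL cU η₁ η₂ σ c₀ a lam) (hl : lam ≤ l) :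
    Admissible n p q qs cL cU η₁ η₂ σ c₀ a l :=
  ⟨h.1.trans (EReal.coe_le_coe_iff.2 hl), h.2.trans hl⟩

/-- The noise term of the energy inequality on the good set, for penalty levels above
`lam_{n,p}`. -/
lemma noise_le_of_mem_noiseSet {β g : Fin p → ℝ} {c₀ a σ cU lam : ℝ} {z : E n}
    (hz : z ∈ noiseSet X β c₀ a) (hn : 1 ≤ n) (hcU : 0 < cU) (hσ : 0 < σ) (hl : 0 < lam)
    (hlam : lamNP n p σ c₀ a cU ≤ lam) {A A₀ : Finset (Fin p)}
    (hgA : ∀ j ∈ A ∩ A₀, |g j| = lam) {v : E n}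
    (hv : IsDual X A (fun j => if j ∈ A₀ then g j else 0) v) :
    ⟪v - missed X β A, σ • z⟫ ≤ 1 / 2 * scale n cU lam * √(max (A.card : ℝ) 1)
        * √(‖v‖ ^ 2 + ‖missed X β A‖ ^ 2) := by
  have hn' : (0 : ℝ) < n := by exact_mod_cast hn
  have hs : (fun j => if j ∈ A ∩ A₀ then lam⁻¹ * g j else 0) ∈ signVectors A := by
    refine mem_signVectors.2 ⟨fun j _ => ?_, fun j hj => ?_⟩
    · by_cases hj : j ∈ A ∩ A₀
      · simp only [hj, if_true]
        rcases eq_or_eq_neg_of_abs_eq (hgA j hj) with h | h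
        · exact Or.inr (Or.inr (by rw [h, inv_mul_cancel₀ hl.ne']))
        · exact Or.inl (by rw [h, mul_neg, inv_mul_cancel₀ hl.ne'])
      · simp [hj]
    · have : j ∉ A ∩ A₀ := fun h => hj (Finset.mem_inter.1 h).1
      simp only [this, if_false]
  have hu : IsDual X A (fun j => if j ∈ A ∩ A₀ then lam⁻¹ * g j else 0) (lam⁻¹ • v) :=
    (hv.smul lam⁻¹).congr fun j hj => by by_cases hj0 : j ∈ A₀ <;> simp [hj, hj0]
  have h1 := inner_le_of_mem_noiseSet hz hs hu lam
  rw [smul_inv_smul₀ hl.ne'] at h1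
  have h2 : σ * √(noiseLevel p c₀ a A.card)
      ≤ 1 / 2 * scale n cU lam * √(max (A.card : ℝ) 1) := by
    have e1 : noiseLevel p c₀ a A.card
        = max (A.card : ℝ) 1 * (2 * (1 + c₀) * Real.log (max (p : ℝ) a)) := by
      unfold noiseLevel; ring
    have e2 : 2 * (1 + c₀) * cU * n * Real.log (max (p : ℝ) a)
        = cU * n * (2 * (1 + c₀) * Real.log (max (p : ℝ) a)) := by ring
    have hs0 : 0 < √(cU * n) := Real.sqrt_pos.2 (by positivity)
    rw [lamNP, e2, Real.sqrt_mul (by positivity)] at hlam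
    have h3 : 2 * σ * √(2 * (1 + c₀) * Real.log (max (p : ℝ) a)) ≤ scale n cU lam := by
      rw [scale, le_div_iff₀ hs0]
      linarith
    rw [e1, Real.sqrt_mul (zero_le_one.trans (le_max_right _ _))]
    have h4 := mul_le_mul_of_nonneg_right h3 (Real.sqrt_nonneg (max (A.card : ℝ) 1))
    linarith
  rw [real_inner_smul_right]
  calc σ * ⟪v - missed X β A, z⟫
      ≤ σ * (√(‖v‖ ^ 2 + ‖missed X β A‖ ^ 2) * √(noiseLevel p c₀ a A.card)) :=
        mul_le_mul_of_nonneg_left h1 hσ.le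
    _ = (σ * √(noiseLevel p c₀ a A.card)) * √(‖v‖ ^ 2 + ‖missed X β A‖ ^ 2) := by ring
    _ ≤ _ := mul_le_mul_of_nonneg_right h2 (Real.sqrt_nonneg _)

/-- The dimension bound for any model between the active set and the equicorrelation set, augmented
by `A₀ᶜ`, once its size is within the range of the sparse Riesz condition. -/
lemma IsLasso.card_le_M₁ {β b : Fin p → ℝ} {c₀ a σ lam : ℝ} {z : E n} {A A₀ : Finset (Fin p)}
    {q qs : ℕ} {cL cU η₁ : ℝ} (hb : IsLasso X (fit X β + σ • z) lam b)
    (hz : z ∈ noiseSet X β c₀ a) (hn : 1 ≤ n) (hq : 1 ≤ q) (hsp : Sparse β A₀ q η₁)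
    (hR : SparseRiesz X qs cL cU) (hσ : 0 < σ) (hl : 0 < lam)
    (hlam : lamNP n p σ c₀ a cU ≤ lam) (hA : selected b ⊆ A) (hA₀ : A₀ᶜ ⊆ A)
    (hAe : A ⊆ equicorr X (fit X β + σ • z) lam b ∪ A₀ᶜ) (hc : A.card ≤ qs) :
    (A.card : ℝ) ≤ M₁ n q cL cU η₁ (eta₂ X β A₀) lam * q := by
  have hcL : 0 < cL := hR.2.1
  have hcU : 0 < cU := hcL.trans hR.2.2.1
  have hgA : ∀ j ∈ A ∩ A₀, |⟪col X j, fit X β + σ • z - fit X b⟫| = lam := by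
    intro j hj
    obtain ⟨h1, h2⟩ := Finset.mem_inter.1 hj
    rcases Finset.mem_union.1 (hAe h1) with h | h
    · exact mem_equicorr.1 h
    · exact absurd h2 (Finset.mem_compl.1 h)
  obtain ⟨-, a', ha, H⟩ := normalized_energy hn hq hsp hR hl (fun j => rfl)
    (hb.abs_inner_le hl.le) (hb.inner_mul_eq hl.le)
    (fun j hj => by by_contra h; exact hj (hA (mem_selected.2 h))) hgA
    (by rwa [Finset.union_eq_left.2 hA₀])
    (fun v hv => noise_le_of_mem_noiseSet hz hn hcU hσ hl hlam hgA hv)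
    rfl rfl rfl rfl rfl rfl rfl rfl
  have e1 : A₀ᶜ \ A = ∅ := Finset.sdiff_eq_empty_iff_subset.2 hA₀
  have e2 : A \ A₀ = A₀ᶜ := by
    ext j
    simp only [Finset.mem_sdiff, Finset.mem_compl]
    exact ⟨fun h => h.2, fun h => ⟨hA₀ (Finset.mem_compl.2 h), h⟩⟩
  rw [e1, e2, hsp.1] at H
  rw [e2, hsp.1] at ha
  simp only [Finset.sum_empty, mul_zero, Real.sqrt_zero, zero_div, zero_add, Finset.card_empty,
    Nat.cast_zero, add_zero] at H
  have hm1 : (1 : ℝ) ≤ A.card := by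
    exact_mod_cast hq.trans (hsp.1 ▸ Finset.card_le_card hA₀)
  have h1 := dimension_le_of_energy hm1 ha H
  have hC : √(cU / cL) ^ 2 = cU / cL := Real.sq_sqrt (by positivity)
  rw [Real.sq_sqrt (Nat.cast_nonneg q), hC] at h1
  exact h1

/-- At an admissible level, on the good set, no LASSO model leaves the range of the sparse Riesz
condition. -/
lemma IsLasso.card_selected_union_lt {β b : Fin p → ℝ} {c₀ a σ lam : ℝ} {z : E n}
    {A₀ : Finset (Fin p)} {q qs : ℕ} {cL cU η₁ : ℝ} (hb : IsLasso X (fit X β + σ • z) lam b)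
    (hz : z ∈ noiseSet X β c₀ a) (hn : 1 ≤ n) (hq : 1 ≤ q) (hsp : Sparse β A₀ q η₁)
    (hR : SparseRiesz X qs cL cU) (hσ : 0 < σ) (hc₀ : 0 ≤ c₀)
    (hadm : Admissible n p q qs cL cU η₁ (eta₂ X β A₀) σ c₀ a lam) :
    (selected b ∪ A₀ᶜ).card < qs := by
  have hcL : 0 < cL := hR.2.1
  have hcU : 0 < cU := hcL.trans hR.2.2.1
  have hl : 0 < lam := hadm.pos hR hn hq hσ hc₀
  have hη₁ : 0 ≤ η₁ := (Finset.sum_nonneg fun j _ => abs_nonneg _).trans hsp.2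
  refine Lasso.card_selected_union_lt hl ?_ ?_ hb
  · have h1 := hadm.M₁_mul_add_one_le hl hcU.le hη₁ hq
    have h2 := two_le_M₁ (n := n) (q := q) (η₁ := η₁) (η₂ := eta₂ X β A₀) (l := lam) hcL.le hcU.le
    have h3 : (q : ℝ) ≤ qs := by nlinarith [(Nat.cast_nonneg q : (0 : ℝ) ≤ q)]
    rw [hsp.1]
    exact_mod_cast h3
  · intro l hll b' hb' A h1 h2 h3 h4
    have hl' : 0 < l := hl.trans_le hll
    have h5 := hb'.card_le_M₁ hz hn hq hsp hR hσ hl' (hadm.2.trans hll) h1 h2 h3 h4.le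
    have h6 := (hadm.mono hll).M₁_mul_add_one_le hl' hcU.le hη₁ hq
    rw [h4] at h5
    linarith

lemma zeta_two_sq (β b : Fin p → ℝ) (A₀ : Finset (Fin p)) :
    zeta β A₀ 2 b ^ 2 = ∑ j ∈ A₀ᶜ \ selected b, β j ^ 2 := by
  have e : A₀ᶜ \ selected b = A₀ᶜ.filter fun j => b j = 0 := by
    ext j; simp [mem_selected]
  have h : ∑ j ∈ A₀ᶜ, |β j| ^ (2 : ℝ≥0∞).toReal * (if b j = 0 then 1 else 0)
      = ∑ j ∈ A₀ᶜ \ selected b, β j ^ 2 := by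
    rw [e, Finset.sum_filter]
    refine Finset.sum_congr rfl fun j _ => ?_
    rw [ENNReal.toReal_ofNat, Real.rpow_ofNat, sq_abs]
    split_ifs <;> simp
  rw [zeta, if_neg two_ne_zero, if_neg ENNReal.ofNat_ne_top, h, ENNReal.toReal_ofNat,
    ← Real.sqrt_eq_rpow, Real.sq_sqrt (Finset.sum_nonneg fun j _ => sq_nonneg _)]

lemma zeta_eq_zero {β b : Fin p → ℝ} {A₀ : Finset (Fin p)} (h : A₀ᶜ ⊆ selected b) {α : ℝ≥0∞}
    (hα : 0 < α) : zeta β A₀ α b = 0 := by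
  have hb : ∀ j ∈ A₀ᶜ, b j ≠ 0 := fun j hj => mem_selected.1 (h hj)
  rw [zeta, if_neg hα.ne']
  split_ifs with h1
  · rw [Finset.filter_false_of_mem hb]
    simp
  · rw [Finset.sum_eq_zero fun j hj => by rw [if_neg (hb j hj), mul_zero], Real.zero_rpow]
    exact one_div_ne_zero (ENNReal.toReal_pos hα.ne' h1).ne'

lemma bias_le_eta₂ {β : Fin p → ℝ} {A A₀ : Finset (Fin p)} (h : A₀ᶜ ⊆ A) :
    bias X β A ≤ eta₂ X β A₀ := by
  have e : missed X β A
      = subfit X Aᶜ β - (modelSpan X A).starProjection (subfit X Aᶜ β) := by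
    rw [missed, fit_eq_subfit_add_subfit_compl X β A, map_add,
      Submodule.starProjection_eq_self_iff.2 (subfit_mem_modelSpan A β)]
    abel
  rw [bias_eq_norm_missed, e]
  exact (norm_sub_starProjection_le _ _).trans
    (norm_subfit_le_eta₂ β (compl_le_iff_compl_le.1 h))

/-- The bounds on the model size, the bias and the missed coefficients on the good set. -/
lemma IsLasso.bounds {β b : Fin p → ℝ} {c₀ a σ lam : ℝ} {z : E n}
    {A₀ : Finset (Fin p)} {q qs : ℕ} {cL cU η₁ : ℝ} (hb : IsLasso X (fit X β + σ • z) lam b)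
    (hz : z ∈ noiseSet X β c₀ a) (hn : 1 ≤ n) (hq : 1 ≤ q) (hsp : Sparse β A₀ q η₁)
    (hR : SparseRiesz X qs cL cU) (hσ : 0 < σ) (hc₀ : 0 ≤ c₀)
    (hadm : Admissible n p q qs cL cU η₁ (eta₂ X β A₀) σ c₀ a lam) :
    ((selected b ∪ A₀ᶜ).card : ℝ) ≤ M₁ n q cL cU η₁ (eta₂ X β A₀) lam * q ∧
      bias X β (selected b) ^ 2
        ≤ M₂ n q cL cU η₁ (eta₂ X β A₀) lam * (q * lam ^ 2 / (cU * n)) ∧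
      zeta β A₀ 2 b ^ 2 ≤ threshold n q cL cU η₁ (eta₂ X β A₀) lam ∧
      ∀ j, threshold n q cL cU η₁ (eta₂ X β A₀) lam < β j ^ 2 → j ∈ selected b := by
  have hn' : (0 : ℝ) < n := by exact_mod_cast hn
  have hq' : (0 : ℝ) < q := by exact_mod_cast hq
  have hcL : 0 < cL := hR.2.1
  have hcU : 0 < cU := hcL.trans hR.2.2.1
  have hl : 0 < lam := hadm.pos hR hn hq hσ hc₀
  have hc : (selected b ∪ A₀ᶜ).card ≤ qs :=
    (hb.card_selected_union_lt hz hn hq hsp hR hσ hc₀ hadm).le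
  have hτ : 0 < scale n cU lam := scale_pos hn hcU hl
  have hτ2 : scale n cU lam ^ 2 = lam ^ 2 / (cU * n) := scale_sq hcU
  have hgA : ∀ j ∈ selected b ∩ A₀, |⟪col X j, fit X β + σ • z - fit X b⟫| = lam :=
    fun j hj => hb.abs_inner_eq hl.le (Finset.mem_inter.1 hj).1
  obtain ⟨hzw, a', ha, H⟩ := normalized_energy hn hq hsp hR hl (fun j => rfl)
    (hb.abs_inner_le hl.le) (hb.inner_mul_eq hl.le)
    (fun j hj => by by_contra h; exact hj (mem_selected.2 h)) hgA hc
    (fun v hv => noise_le_of_mem_noiseSet hz hn hcU hσ hl hadm.2 hgA hv)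
    rfl rfl rfl rfl rfl rfl rfl rfl
  have hxy : √((selected b \ A₀).card : ℝ) ^ 2 + √((A₀ᶜ \ selected b).card : ℝ) ^ 2 = √q ^ 2 := by
    rw [Real.sq_sqrt (Nat.cast_nonneg _), Real.sq_sqrt (Nat.cast_nonneg _),
      Real.sq_sqrt (Nat.cast_nonneg _), ← hsp.1]
    have e : selected b \ A₀ = A₀ᶜ ∩ selected b := by
      ext j
      simp only [Finset.mem_sdiff, Finset.mem_inter, Finset.mem_compl]
      tauto
    rw [e]
    exact_mod_cast Finset.card_inter_add_card_sdiff A₀ᶜ (selected b)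
  have hQ2 : √(q : ℝ) ^ 2 = q := Real.sq_sqrt hq'.le
  have hC2 : √(cU / cL) ^ 2 = cU / cL := Real.sq_sqrt (by positivity)
  have hκ1 : 1 ≤ √(cU / cL) := Real.one_le_sqrt.2 ((one_le_div hcL).2 hR.2.2.1.le)
  have hr0 : 0 ≤ r₂ n q cU (eta₂ X β A₀) lam := Real.sqrt_nonneg _
  have hcommon := sq_le_of_energy hxy (by rw [hQ2]; exact_mod_cast hq) ha H
  have hM2 := bias_sq_le_of_energy hκ1 hr0 (Real.sqrt_nonneg _) (Real.sqrt_nonneg _)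
    (Real.sqrt_nonneg _) hxy hzw hcommon
  have hM3 := missed_sq_le_of_energy (zero_le_one.trans hκ1) hr0 (Real.sqrt_nonneg _)
    (Real.sqrt_nonneg _) (div_nonneg (Real.sqrt_nonneg _) hτ.le)
    (Real.sqrt_nonneg (1 + cU / cL))
    (by rw [Real.sq_sqrt (by positivity), hC2]) hxy hzw hcommon
  rw [hC2, hQ2, ← Real.sqrt_mul zero_le_two, div_pow, div_le_iff₀ (by positivity)] at hM2
  have hS0 : 0 ≤ ∑ j ∈ A₀ᶜ \ selected b, β j ^ 2 := Finset.sum_nonneg fun j _ => sq_nonneg _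
  rw [hC2, hQ2, div_pow, div_le_iff₀ (by positivity), Real.sq_sqrt (by positivity)] at hM3
  have hthr : cL * n * threshold n q cL cU η₁ (eta₂ X β A₀) lam
      = M₃ n q cL cU η₁ (eta₂ X β A₀) lam * q * scale n cU lam ^ 2 := by
    rw [hτ2, threshold]
    field_simp
  have hcLn : 0 < cL * (n : ℝ) := by positivity
  have hζ : ∑ j ∈ A₀ᶜ \ selected b, β j ^ 2 ≤ threshold n q cL cU η₁ (eta₂ X β A₀) lam := by
    refine le_of_mul_le_mul_left ?_ hcLn
    rw [hthr]
    exact hM3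
  refine ⟨?_, ?_, ?_, ?_⟩
  · exact hb.card_le_M₁ hz hn hq hsp hR hσ hl hadm.2 Finset.subset_union_left
      Finset.subset_union_right
      (Finset.union_subset_union_left (hb.selected_subset_equicorr hl.le)) hc
  · rw [bias_eq_norm_missed]
    refine hM2.trans (le_of_eq ?_)
    rw [hτ2, M₂]
    ring
  · rw [zeta_two_sq]
    exact hζ
  · intro j hj
    by_contra hjs
    refine absurd hj (not_lt.2 ?_)
    by_cases hj0 : j ∈ A₀
    · -- for `j ∈ A₀` already `‖β_j x_j‖ ≤ η₂`, and `M₃^* ≥ 2 r₂²`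
      refine le_of_mul_le_mul_left ?_ hcLn
      have h1 : 1 ≤ qs := hq.trans
        (hsp.1 ▸ (Finset.card_le_card Finset.subset_union_right).trans hc)
      have h2 := (hR.of_card_le (A := {j}) (by simpa using h1) β).1
      rw [Finset.sum_singleton] at h2
      have h3 := norm_subfit_le_eta₂ (X := X) β (Finset.singleton_subset_iff.2 hj0)
      have h4 : eta₂ X β A₀ ^ 2
          = r₂ n q cU (eta₂ X β A₀) lam ^ 2 * q * scale n cU lam ^ 2 := by
        nth_rewrite 1 [← r₂_mul_scale (q := q) hn hq hcU hl ((norm_nonneg _).trans h3)]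
        rw [mul_pow, mul_pow, hQ2]
      have h5 : r₂ n q cU (eta₂ X β A₀) lam ^ 2 ≤ M₃ n q cL cU η₁ (eta₂ X β A₀) lam := by
        have : 0 ≤ 1 / 4 + r₁ n q cU η₁ lam ^ 2
            + r₂ n q cU (eta₂ X β A₀) lam * √(cU / cL) * (1 + 2 * √(1 + cU / cL))
            + cU / cL * (7 / 6 + 2 / 3 * (cU / cL)) := by positivity
        unfold M₃
        nlinarith [sq_nonneg (r₂ n q cU (eta₂ X β A₀) lam)]
      rw [hthr]
      refine h2.trans ((pow_le_pow_left₀ (norm_nonneg _) h3 2).trans (h4.trans_le ?_))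
      exact mul_le_mul_of_nonneg_right (mul_le_mul_of_nonneg_right h5 hq'.le) (sq_nonneg _)
    · exact (Finset.single_le_sum (f := fun j => β j ^ 2) (fun j _ => sq_nonneg _)
        (Finset.mem_sdiff.2 ⟨Finset.mem_compl.2 hj0, hjs⟩)).trans hζ

end Lasso

theorem theorem2 {n p : ℕ} (hn : 1 ≤ n) (X : Matrix (Fin n) (Fin p) ℝ) (β : Fin p → ℝ)
    (c₀ a : ℝ) (hc₀ : 0 ≤ c₀) (ha : 0 ≤ a) :
    -- a single event, chosen from `X`, `β`, `c₀`, `a` only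
    (∃ Ω₀ : Set (Lasso.E n), MeasurableSet Ω₀ ∧
      ∀ (σ : ℝ), 0 < σ →
      ∀ (Ω : Type*) [MeasurableSpace Ω] (P : Measure Ω) [IsProbabilityMeasure P]
        (ε : Ω → Lasso.E n),
        HasLaw ε (multivariateGaussian 0 (σ ^ 2 • (1 : Matrix (Fin n) (Fin n) ℝ))) P →
      ∀ (A₀ : Finset (Fin p)) (q : ℕ) (η₁ : ℝ), 1 ≤ q → Lasso.Sparse β A₀ q η₁ →
      ∀ (qs : ℕ) (cL cU : ℝ), Lasso.SparseRiesz X qs cL cU →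
      ∀ η₂ : ℝ, η₂ = Lasso.eta₂ X β A₀ →
        -- the event has probability near one
        Lasso.probBound p a c₀ ≤ P.real {ω | σ⁻¹ • ε ω ∈ Ω₀} ∧
        -- on the event, sparsity, bias and missed coefficients are controlled, and every variable
        -- above the threshold is selected
        (∀ ω, σ⁻¹ • ε ω ∈ Ω₀ →
          ∀ lam : ℝ, Lasso.Admissible n p q qs cL cU η₁ η₂ σ c₀ a lam →
            (∃ b, Lasso.IsLasso X (Lasso.fit X β + ε ω) lam b) ∧
            ∀ b, Lasso.IsLasso X (Lasso.fit X β + ε ω) lam b →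
              ((Lasso.selected b).card ≤ (Lasso.selected b ∪ A₀ᶜ).card ∧
                ((Lasso.selected b ∪ A₀ᶜ).card : ℝ) ≤ Lasso.M₁ n q cL cU η₁ η₂ lam * q) ∧
              Lasso.bias X β (Lasso.selected b) ^ 2
                ≤ Lasso.M₂ n q cL cU η₁ η₂ lam * (q * lam ^ 2 / (cU * n)) ∧
              Lasso.zeta β A₀ 2 b ^ 2 ≤ Lasso.threshold n q cL cU η₁ η₂ lam ∧
              ∀ j, Lasso.threshold n q cL cU η₁ η₂ lam < β j ^ 2 → j ∈ Lasso.selected b) ∧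
        -- if all large coefficients exceed the threshold
        (∀ lam : ℝ, Lasso.Admissible n p q qs cL cU η₁ η₂ σ c₀ a lam →
          (∀ j ∉ A₀, Lasso.threshold n q cL cU η₁ η₂ lam < β j ^ 2) →
          ∀ α : ℝ≥0∞, 0 < α →
            Lasso.probBound p a c₀ ≤
              P.real {ω | (∃ b, Lasso.IsLasso X (Lasso.fit X β + ε ω) lam b) ∧
                ∀ b, Lasso.IsLasso X (Lasso.fit X β + ε ω) lam b →
                  A₀ᶜ ⊆ Lasso.selected b ∧
                  Lasso.bias X β (Lasso.selected b) ≤ η₂ ∧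
                  Lasso.zeta β A₀ α b = 0})) ∧
    -- the probability bound tends to one whenever `p / (p ∨ a)^{1 + c₀}` tends to zero
    (∀ (ps : ℕ → ℕ) (as cs : ℕ → ℝ), (∀ k, 1 ≤ ps k) → (∀ k, 0 ≤ as k) → (∀ k, 0 ≤ cs k) →
      Tendsto (fun k => (ps k : ℝ) / max (ps k : ℝ) (as k) ^ (1 + cs k)) atTop (𝓝 0) →
      Tendsto (fun k => Lasso.probBound (ps k) (as k) (cs k)) atTop (𝓝 1)) := by
  refine ⟨⟨Lasso.noiseSet X β c₀ a, Lasso.measurableSet_noiseSet X β c₀ a, ?_⟩,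
    fun ps as cs hps _ _ h => Lasso.tendsto_probBound hps h⟩
  intro σ hσ Ω _ P _ ε hε A₀ q η₁ hq hsp qs cL cU hR η₂ hη₂
  subst hη₂
  have hp : 1 ≤ p := by
    have h1 := Finset.card_le_univ A₀ᶜ
    rw [hsp.1, Fintype.card_fin] at h1
    exact hq.trans h1
  have hprob : Lasso.probBound p a c₀ ≤ P.real {ω | σ⁻¹ • ε ω ∈ Lasso.noiseSet X β c₀ a} := by
    rw [(Lasso.hasLaw_inv_smul_stdGaussian hσ hε).measureReal_eq
      (p := fun z => z ∈ Lasso.noiseSet X β c₀ a) (Lasso.measurableSet_noiseSet X β c₀ a)]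
    exact Lasso.probBound_le_stdGaussian_noiseSet hp hc₀ X β
  have hdet : ∀ ω, σ⁻¹ • ε ω ∈ Lasso.noiseSet X β c₀ a → ∀ lam : ℝ,
      Lasso.Admissible n p q qs cL cU η₁ (Lasso.eta₂ X β A₀) σ c₀ a lam →
      (∃ b, Lasso.IsLasso X (Lasso.fit X β + ε ω) lam b) ∧
        ∀ b, Lasso.IsLasso X (Lasso.fit X β + ε ω) lam b → _ :=
    fun ω hω lam hadm => ⟨Lasso.exists_isLasso X _ (hadm.pos hR hn hq hσ hc₀), fun b hb =>
      Lasso.IsLasso.bounds (by rwa [smul_inv_smul₀ hσ.ne']) hω hn hq hsp hR hσ hc₀ hadm⟩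
  refine ⟨hprob, fun ω hω lam hadm => ?_, fun lam hadm hlarge α hα => ?_⟩
  · refine ⟨(hdet ω hω lam hadm).1, fun b hb => ?_⟩
    obtain ⟨h1, h2, h3, h4⟩ := (hdet ω hω lam hadm).2 b hb
    exact ⟨⟨Finset.card_le_card Finset.subset_union_left, h1⟩, h2, h3, h4⟩
  · refine hprob.trans (measureReal_mono fun ω hω => ?_)
    refine ⟨(hdet ω hω lam hadm).1, fun b hb => ?_⟩
    have hsub : A₀ᶜ ⊆ Lasso.selected b := fun j hj =>
      ((hdet ω hω lam hadm).2 b hb).2.2.2 j (hlarge j (Finset.mem_compl.1 hj))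
    exact ⟨hsub, Lasso.bias_le_eta₂ hsub, Lasso.zeta_eq_zero hsub hα⟩
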